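/- Let $\ell\in\{5,7\}$. For an elliptic curve $E$ over $\mathbb{Q}$, let $c_p(E)=[E(\mathbb{Q}_p):E_0(\mathbb{Q}_p)]$ be its local Tamagawa number at a prime $p$, where $E_0(\mathbb{Q}_p)$ is the group of points with nonsingular reduction on a minimal Weierstrass model at $p$, and let $c(E)=\prod_p c_p(E)$ be its global Tamagawa number. For a rational point $P$ of order $\ell$ on $E$, let $E/\langle P\rangle$ be the quotient elliptic curve: the codomain of an isogeny over $\mathbb{Q}$ with kernel $\langle P\rangle$, unique up to $\mathbb{Q}$-isomorphism. For numbers $a,b$ let $$E_5(a,b):\ y^2+(a-b)xy-a^2b\,y=x^3-ab\,x^2,$$ $$E_7(a,b):\ y^2+(a^2+ab-b^2)xy+(a^4b^2-a^3b^3)y=x^3+(a^2b^2-ab^3)x^2,$$ and let $\widetilde E_\ell(a,b)$ be the curve obtained from $E_\ell(a,b)$ by adding $a_4x+a_6$ to the right-hand side, where for $\ell=5$ $$a_4=5ab(a^2-2ab-b^2),\qquad a_6=ab(a^4-15a^3b+5a^2b^2-10ab^3-b^4),$$ and for $\ell=7$ $$a_4=5ab(a-b)(a^2-ab+b^2)(a^3-5a^2b+2ab^2+b^3),$$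 $$a_6=ab(a-b)(a^9-18a^8b+76a^7b^2-182a^6b^3+211a^5b^4-132a^4b^5+70a^3b^6-37a^2b^7+9ab^8+b^9).$$ Then the following hold. 1. There are infinitely many elliptic curves $\widetilde E=E/\langle P\rangle$, up to $\mathbb{Q}$-isomorphism, with $E$ an elliptic curve over $\mathbb{Q}$ and $P\in E(\mathbb{Q})$ a point of order $\ell$, such that $\ell\mid c(\widetilde E)$. 2. Let $a,b$ be relatively prime positive integers such that, for some prime $q$ dividing $ab$, the exponent $v_q(ab)$ is divisible by $\ell$. Then $E_\ell(a,b)$ and $\widetilde E_\ell(a,b)$ are elliptic curves, $P=(0,0)$ is a point of order $\ell$ on $E_\ell(a,b)$, $E_\ell(a,b)/\langle P\rangle$ is $\widetilde E_\ell(a,b)$, and $\ell\mid c(\widetilde E_\ell(a,b))$. 3. The curves $\widetilde E_\ell(a,b)$ of part 2 fall into infinitely many $\mathbb{Q}$-isomorphism classes. -/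

import Mathlib

open scoped WeierstrassCurve.Affine

namespace TamagawaIsogeny

/-! ### `ℚ`-isomorphism classes -/

/-- `ℚ`-isomorphism classes of Weierstrass curves over `ℚ`: two curves are identified when they
differ by a change of variables `(x, y) ↦ (u²x + r, u³y + u²sx + t)` with `u, r, s, t ∈ ℚ`,
`u ≠ 0`. -/
abbrev IsoClass : Type :=
  MulAction.orbitRel.Quotient (WeierstrassCurve.VariableChange ℚ) (WeierstrassCurve ℚ)

/-- The `ℚ`-isomorphism class of a Weierstrass curve. -/
def isoClass (W : WeierstrassCurve ℚ) : IsoClass :=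
  Quotient.mk (MulAction.orbitRel (WeierstrassCurve.VariableChange ℚ) (WeierstrassCurve ℚ)) W

/-! ### Tamagawa numbers -/

section Tamagawa

variable (R : Type*) [CommRing R] [IsDomain R] [IsDiscreteValuationRing R]
  {K : Type*} [Field K] [Algebra R K] [IsFractionRing R K]

/-- A point of a minimal Weierstrass model has nonsingular reduction. The point at infinity and
the affine points with non-integral coordinates reduce to the (nonsingular) point at infinity; an
affine point with integral coordinates `(x₀, y₀)` reduces to the point with coordinates
`(x₀ mod 𝔪, y₀ mod 𝔪)` of the reduced curve. -/
def HasNonsingularReduction (W : WeierstrassCurve K) [W.IsMinimal R] : W.toAffine.Point → Prop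
  | .zero => True
  | .some x y _ => ∀ x₀ y₀ : R, algebraMap R K x₀ = x → algebraMap R K y₀ = y →
      (W.reduction R).toAffine.Nonsingular
        (IsLocalRing.residue R x₀) (IsLocalRing.residue R y₀)

open Classical in
/-- The subgroup `E₀(K)` of the points with nonsingular reduction on a minimal model. (For an
elliptic curve, the set of these points is already a subgroup, and so it is equal to the subgroup
that it generates.) -/
noncomputable def nonsingularReductionSubgroup (W : WeierstrassCurve K) [W.IsMinimal R] :
    AddSubgroup W.toAffine.Point :=
  AddSubgroup.closure {P | HasNonsingularReduction R W P}

open Classical in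
/-- The index `[E(K) : E₀(K)]`, computed on a minimal model of the curve. -/
noncomputable def componentIndex (W : WeierstrassCurve K) : ℕ :=
  (nonsingularReductionSubgroup R (W.minimal R)).index

end Tamagawa

/-- The local Tamagawa number `c_p = [E(ℚ_p) : E₀(ℚ_p)]` of a curve over `ℚ`. -/
noncomputable def localTamagawa (W : WeierstrassCurve ℚ) (p : ℕ) [Fact p.Prime] : ℕ :=
  componentIndex ℤ_[p] (W.map (algebraMap ℚ ℚ_[p]))

/-- The global Tamagawa number `∏_p c_p`. All but finitely many factors are equal to `1`. -/
noncomputable def globalTamagawa (W : WeierstrassCurve ℚ) : ℕ :=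
  ∏ᶠ p : Nat.Primes, haveI : Fact (p : ℕ).Prime := ⟨p.2⟩; localTamagawa W p

/-! ### Isogenies and quotients by a finite cyclic subgroup -/

/-- An algebraic closure of `ℚ`. -/
abbrev QBar : Type := AlgebraicClosure ℚ

/-- The points of a Weierstrass curve over `ℚ` with coordinates in an algebraic closure. -/
abbrev GeomPoint (W : WeierstrassCurve ℚ) : Type :=
  (W.map (algebraMap ℚ QBar)).toAffine.Point

/-- A rational point, viewed as a geometric point. -/
noncomputable def toGeom (W : WeierstrassCurve ℚ) : W.toAffine.Point → GeomPoint W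
  | .zero => .zero
  | .some x y h => .some (algebraMap ℚ QBar x) (algebraMap ℚ QBar y)
      ((W.toAffine.map_nonsingular (algebraMap ℚ QBar).injective x y).mpr h)

/-- Homogeneous coordinates of a geometric point in the projective plane: `[0 : 1 : 0]` for the
point at infinity and `[x : y : 1]` for an affine point `(x, y)`. -/
noncomputable def homCoords {W : WeierstrassCurve ℚ} : GeomPoint W → Fin 3 → QBar
  | .zero => ![0, 1, 0]
  | .some x y _ => ![x, y, 1]

/-- The value at a geometric point of a triple of polynomials with rational coefficients. -/
noncomputable def evalTriple {W : WeierstrassCurve ℚ} (F : Fin 3 → MvPolynomial (Fin 3) ℚ)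
    (S : GeomPoint W) : Fin 3 → QBar :=
  fun i => MvPolynomial.aeval (homCoords S) (F i)

/-- A map on geometric points is a morphism of plane projective curves defined over `ℚ`: around
each point it is given, wherever they do not vanish simultaneously, by three homogeneous
polynomials of the same degree with rational coefficients. -/
def IsMorphism {W W' : WeierstrassCurve ℚ} (φ : GeomPoint W → GeomPoint W') : Prop :=
  ∀ R : GeomPoint W, ∃ (d : ℕ) (F : Fin 3 → MvPolynomial (Fin 3) ℚ),
    (∀ i, (F i).IsHomogeneous d) ∧ evalTriple F R ≠ 0 ∧
      ∀ S : GeomPoint W, evalTriple F S ≠ 0 →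
        ∃ c : QBar, c ≠ 0 ∧ evalTriple F S = c • homCoords (φ S)

/-- `W'` is (a model of) the quotient `W / ⟨P⟩` of the elliptic curve `W` by the subgroup that a
rational point `P` generates: there is an isogeny `W → W'` over `ℚ`, that is a morphism that maps
`O` to `O`, whose kernel is `⟨P⟩`. In characteristic zero this determines `W'` up to
`ℚ`-isomorphism when `P` has finite order. -/
def IsQuotientBy (W : WeierstrassCurve ℚ) (P : W.toAffine.Point) (W' : WeierstrassCurve ℚ) :
    Prop :=
  ∃ φ : GeomPoint W → GeomPoint W', IsMorphism φ ∧ φ .zero = .zero ∧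
    ∀ R : GeomPoint W, φ R = .zero ↔ ∃ n : ℤ, R = toGeom W (n • P)

/-! ### The parametrized families -/

/-- The two-parameter family of curves `y² + a₁xy + a₃y = x³ + a₂x²` on which `(0, 0)` is a point
of order `ℓ`, for `ℓ = 5` and for `ℓ = 7` (used only for these two values of `ℓ`). -/
def torsionCurve (ℓ : ℕ) (a b : ℚ) : WeierstrassCurve ℚ :=
  if ℓ = 5 then
    { a₁ := a - b
      a₂ := -(a * b)
      a₃ := -(a ^ 2 * b)
      a₄ := 0
      a₆ := 0 }
  else
    { a₁ := a ^ 2 + a * b - b ^ 2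
      a₂ := a ^ 2 * b ^ 2 - a * b ^ 3
      a₃ := a ^ 4 * b ^ 2 - a ^ 3 * b ^ 3
      a₄ := 0
      a₆ := 0 }

/-- The curves `ℓ`-isogenous to the curves `torsionCurve ℓ a b`, for `ℓ = 5` and for `ℓ = 7`. -/
def quotientCurve (ℓ : ℕ) (a b : ℚ) : WeierstrassCurve ℚ :=
  if ℓ = 5 then
    { a₁ := a - b
      a₂ := -(a * b)
      a₃ := -(a ^ 2 * b)
      a₄ := 5 * a * b * (a ^ 2 - 2 * a * b - b ^ 2)
      a₆ := a * b * (a ^ 4 - 15 * a ^ 3 * b + 5 * a ^ 2 * b ^ 2 - 10 * a * b ^ 3 - b ^ 4) }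
  else
    { a₁ := a ^ 2 + a * b - b ^ 2
      a₂ := a ^ 2 * b ^ 2 - a * b ^ 3
      a₃ := a ^ 4 * b ^ 2 - a ^ 3 * b ^ 3
      a₄ := 5 * a * b * (a - b) * (a ^ 2 - b * a + b ^ 2) *
        (a ^ 3 - 5 * a ^ 2 * b + 2 * a * b ^ 2 + b ^ 3)
      a₆ := a * b * (a - b) *
        (a ^ 9 - 18 * a ^ 8 * b + 76 * a ^ 7 * b ^ 2 - 182 * a ^ 6 * b ^ 3 +
          211 * a ^ 5 * b ^ 4 - 132 * a ^ 4 * b ^ 5 + 70 * a ^ 3 * b ^ 6 -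
          37 * a ^ 2 * b ^ 7 + 9 * a * b ^ 8 + b ^ 9) }

/-- Admissible parameters: coprime positive integers `a, b` such that, for some prime `q` that
divides `ab`, the exponent of `q` in `ab` is divisible by `ℓ`. -/
def Admissible (ℓ a b : ℕ) : Prop :=
  0 < a ∧ 0 < b ∧ a.Coprime b ∧
    ∃ q : ℕ, q.Prime ∧ q ∣ a * b ∧ ℓ ∣ (a * b).factorization q

end TamagawaIsogeny

/-!
# Tamagawa numbers of quotients by a point of order `5` or `7`

**Local part.** Let `q` be a prime with `v_q(ab) = kℓ`, `k ≥ 1`. As `a` and `b` are coprime, the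
given equation of the quotient curve has, over `ℤ_q`, a unit `a₁`, coefficients `a₂, a₃, a₄`
divisible by `ab`, and `a₆` equal to `ab` times a unit (`isTateForm_map_quotientModel`). So the
reduction has a node at `(0, 0)`, with the rational tangents `y (y + a₁x) = 0`, and `v(Δ) = kℓ`: the
reduction is split multiplicative of type `I_{kℓ}`, and the component group is cyclic of order `kℓ`.

Neither Tate curves nor Néron models are used to find an element of order `ℓ` in the component
group. Hensel's lemma gives a point `P` with `x(P) = q ^ k` (`IsTateForm.exists_hasX`). The sum and
the product of `x(Q + R)` and `x(Q - R)` are rational functions of `x(Q)` and `x(R)`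
(`add_sub_some`), and near the node their sizes are determined by those of `x(Q)` and `x(R)`. This
has two consequences. The points that do not reduce to the node form a subgroup (`awayFromNode`).
And with `v` normalized by `v(q ^ k) = 1`, one gets `v(x(2P)) = v(x(3P)) = 2` for `ℓ = 5`, and
`v(x(2P)) = 2`, `v(x(3P)) = v(x(4P)) = 3` for `ℓ = 7`. Two points with `x`-coordinates of the same
valuation below `ℓ / 2` agree up to sign modulo the subgroup (`not_nearNode_add_or_sub`). Hence `ℓP`
is in the subgroup, whereas `P` is not, and the index is divisible by `ℓ`
(`dvd_index_awayFromNode`). The subgroup `E₀` of the definition is contained in this subgroup. The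
change of variables to the chosen minimal model has a unit `u`, and the argument is carried out on
the minimal model with the `x`-coordinates of the original one (`HasX`).

**Isogeny.** The isogeny with kernel `⟨(0, 0)⟩` is given by Vélu's formulas, in the normalized form
`X = A / D²`, `2Y + a₁X + a₃ = (2y + a₁x + a₃) M / D³` with polynomials `A`, `D`, `M` in `x` alone
(`IsNormalizedIsogeny`). One polynomial identity in `x` then shows that the image lies on the
quotient curve. The map is a morphism at the point at infinity because the equation `X³ = Z Q` of
the curve allows a power of `Z` to be divided out of its homogeneous coordinates
(`IsNormalizedIsogeny.isMorphism`).

**Infinitely many classes.** For `a = 1`, `b = 2 ^ (ℓn)` the `2`-adic valuation of the `j`-invariant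
is `-ℓn`, which separates the classes (`infinite_isoClass_quotientCurve`).
-/

namespace TamagawaIsogeny
open WeierstrassCurve

/-! ### The `x`-coordinates of sums, differences and doubles -/

section XCoordinates

variable {K : Type*} [Field K] [DecidableEq K] {W : WeierstrassCurve K}

/-- The sum and the product of `x(P + Q)` and `x(P - Q)` are rational functions of `x(P)` and
`x(Q)`, so that sizes of `x`-coordinates can be followed through the group law without
`y`-coordinates. -/
theorem add_sub_some {x₁ y₁ x₂ y₂ : K} (h₁ : W.toAffine.Nonsingular x₁ y₁)
    (h₂ : W.toAffine.Nonsingular x₂ y₂) (hx : x₁ ≠ x₂) :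
    ∃ x₃ y₃ h₃ x₄ y₄ h₄,
      Affine.Point.some x₁ y₁ h₁ + .some x₂ y₂ h₂ = Affine.Point.some x₃ y₃ h₃ ∧
      Affine.Point.some x₁ y₁ h₁ - .some x₂ y₂ h₂ = Affine.Point.some x₄ y₄ h₄ ∧
      (x₁ - x₂) ^ 2 * (x₃ + x₄) =
        2 * (x₁ * x₂ * (x₁ + x₂)) + W.b₂ * (x₁ * x₂) + W.b₄ * (x₁ + x₂) + W.b₆ ∧
      (x₁ - x₂) ^ 2 * (x₃ * x₄) =
        (x₁ * x₂) ^ 2 - W.b₄ * (x₁ * x₂) - W.b₆ * (x₁ + x₂) - W.b₈ := by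
  have e₁ := (W.toAffine.equation_iff x₁ y₁).mp h₁.1
  have e₂ := (W.toAffine.equation_iff x₂ y₂).mp h₂.1
  have hd : x₁ - x₂ ≠ 0 := sub_ne_zero.mpr hx
  refine ⟨_, _, _, _, _, _, Affine.Point.add_of_X_ne hx,
    (sub_eq_add_neg _ _).trans (Affine.Point.add_of_X_ne hx), ?_, ?_⟩
  · simp only [Affine.addX, Affine.slope_of_X_ne hx, Affine.negY, WeierstrassCurve.b₂,
      WeierstrassCurve.b₄, WeierstrassCurve.b₆]
    field_simp
    linear_combination 2 * e₁ + 2 * e₂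
  · simp only [Affine.addX, Affine.slope_of_X_ne hx, Affine.negY]
    -- `n / d` and `n' / d` are the slopes of the lines through `P`, `Q` and through `P`, `-Q`
    set n := y₁ - y₂ with hn
    set n' := y₁ - (-y₂ - W.a₁ * x₂ - W.a₃) with hn'
    set d := x₁ - x₂ with hdd
    have hp : n * n' = d * (x₁ ^ 2 + x₁ * x₂ + x₂ ^ 2 + W.a₂ * (x₁ + x₂) + W.a₄ - W.a₁ * y₁) := by
      linear_combination e₁ - e₂
    have hs : (n + n') ^ 2 = 4 * x₁ ^ 3 + W.b₂ * x₁ ^ 2 + 2 * W.b₄ * x₁ + W.b₆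
        - 2 * W.a₁ * d * (2 * y₁ + W.a₁ * x₁ + W.a₃) + W.a₁ ^ 2 * d ^ 2 := by
      simp only [WeierstrassCurve.b₂, WeierstrassCurve.b₄, WeierstrassCurve.b₆]
      linear_combination 4 * e₁
    have hs' : n + n' = 2 * y₁ + W.a₁ * x₁ + W.a₃ - W.a₁ * d := by ring
    have key : d ^ 2 * ((n ^ 2 + W.a₁ * n * d - (W.a₂ + x₁ + x₂) * d ^ 2) *
        (n' ^ 2 + W.a₁ * n' * d - (W.a₂ + x₁ + x₂) * d ^ 2)) =
        d ^ 4 * ((x₁ * x₂) ^ 2 - W.b₄ * (x₁ * x₂) - W.b₆ * (x₁ + x₂) - W.b₈) := by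
      have : (n ^ 2 + W.a₁ * n * d - (W.a₂ + x₁ + x₂) * d ^ 2) *
        (n' ^ 2 + W.a₁ * n' * d - (W.a₂ + x₁ + x₂) * d ^ 2) = (n * n') ^ 2 +
          W.a₁ * d * (n * n') * (n + n') + W.a₁ ^ 2 * d ^ 2 * (n * n')
          - (W.a₂ + x₁ + x₂) * d ^ 2 * ((n + n') ^ 2 - 2 * (n * n'))
          - W.a₁ * (W.a₂ + x₁ + x₂) * d ^ 3 * (n + n')
          + (W.a₂ + x₁ + x₂) ^ 2 * d ^ 4 := by ring
      rw [this, hs, hp, hs']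
      simp only [WeierstrassCurve.b₂, WeierstrassCurve.b₄, WeierstrassCurve.b₆,
        WeierstrassCurve.b₈, hdd]
      linear_combination (-W.a₁ ^ 2 * (x₁ - x₂) ^ 4) * e₁
    have hd' : d ^ 4 ≠ 0 := pow_ne_zero 4 hd
    rw [← mul_right_inj' hd', ← key]
    field_simp
    ring

/-- The duplication formula for the `x`-coordinate, under the condition `2P ≠ O`. -/
theorem double_some {x y : K} (h : W.toAffine.Nonsingular x y)
    (hψ : 4 * x ^ 3 + W.b₂ * x ^ 2 + 2 * W.b₄ * x + W.b₆ ≠ 0) :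
    ∃ x' y' h', 2 • Affine.Point.some x y h = Affine.Point.some x' y' h' ∧
      (4 * x ^ 3 + W.b₂ * x ^ 2 + 2 * W.b₄ * x + W.b₆) * x' =
        x ^ 4 - W.b₄ * x ^ 2 - 2 * W.b₆ * x - W.b₈ := by
  have e := (W.toAffine.equation_iff x y).mp h.1
  have hsq : (y - W.toAffine.negY x y) ^ 2 =
      4 * x ^ 3 + W.b₂ * x ^ 2 + 2 * W.b₄ * x + W.b₆ := by
    simp only [Affine.negY, WeierstrassCurve.b₂, WeierstrassCurve.b₄, WeierstrassCurve.b₆]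
    linear_combination 4 * e
  have hd : y - W.toAffine.negY x y ≠ 0 := fun h0 => hψ (by rw [← hsq, h0]; ring)
  refine ⟨_, _, _, (two_nsmul _).trans (Affine.Point.add_self_of_Y_ne (sub_ne_zero.mp hd)), ?_⟩
  rw [← hsq]
  simp only [Affine.addX, Affine.slope_of_Y_ne rfl (sub_ne_zero.mp hd)]
  have hd2 : y - W.toAffine.negY x y = 2 * y + W.a₁ * x + W.a₃ := by
    simp only [Affine.negY]; ring
  rw [hd2] at hd ⊢
  simp only [WeierstrassCurve.b₄, WeierstrassCurve.b₆, WeierstrassCurve.b₈]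
  field_simp
  linear_combination (-W.a₁ ^ 2 - 4 * W.a₂ - 8 * x) * e

end XCoordinates

/-! ### Points of a changed model measured on the original model -/

section OriginalX

variable {K : Type*} [Field K] {W : WeierstrassCurve K} (C : VariableChange K)

/-- `HasX C P ξ`: the affine point `P` of the curve `C • W` corresponds to a point of `W` with
`x`-coordinate `ξ`. The group law of a minimal model `C • W` is studied through these coordinates,
and no isomorphism between the groups of `C • W` and of `W` is needed. -/
def HasX (P : (C • W).toAffine.Point) (ξ : K) : Prop :=
  ∃ x y h, P = .some x y h ∧ (C.u : K) ^ 2 * x + C.r = ξ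

variable {C} {P Q : (C • W).toAffine.Point} {ξ ξ' ξ₁ ξ₂ : K}

theorem HasX.ne_zero (hP : HasX C P ξ) : P ≠ 0 := by
  obtain ⟨x, y, h, rfl, -⟩ := hP
  exact Affine.Point.some_ne_zero h

theorem HasX.unique (hP : HasX C P ξ) (hP' : HasX C P ξ') : ξ = ξ' := by
  obtain ⟨x, y, h, rfl, rfl⟩ := hP
  obtain ⟨x', y', h', he, rfl⟩ := hP'
  rw [Affine.Point.some.injEq] at he
  rw [he.1]

theorem HasX.neg (hP : HasX C P ξ) : HasX C (-P) ξ := by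
  obtain ⟨x, y, h, rfl, rfl⟩ := hP
  exact ⟨x, _, _, Affine.Point.neg_some h, rfl⟩

theorem HasX.eq_or_eq_neg (hP : HasX C P ξ) (hQ : HasX C Q ξ) : P = Q ∨ P = -Q := by
  obtain ⟨x, y, h, rfl, rfl⟩ := hP
  obtain ⟨x', y', h', rfl, he⟩ := hQ
  refine Affine.Point.X_eq_iff.mp ?_
  have hu : (C.u : K) ^ 2 ≠ 0 := pow_ne_zero 2 C.u.ne_zero
  exact (mul_left_cancel₀ hu (add_right_cancel he)).symm

variable [DecidableEq K]

theorem HasX.add_sub (hP : HasX C P ξ₁) (hQ : HasX C Q ξ₂) (hne : ξ₁ ≠ ξ₂) :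
    ∃ ξ₃ ξ₄, HasX C (P + Q) ξ₃ ∧ HasX C (P - Q) ξ₄ ∧
      (ξ₁ - ξ₂) ^ 2 * (ξ₃ + ξ₄) =
        2 * (ξ₁ * ξ₂ * (ξ₁ + ξ₂)) + W.b₂ * (ξ₁ * ξ₂) + W.b₄ * (ξ₁ + ξ₂) + W.b₆ ∧
      (ξ₁ - ξ₂) ^ 2 * (ξ₃ * ξ₄) =
        (ξ₁ * ξ₂) ^ 2 - W.b₄ * (ξ₁ * ξ₂) - W.b₆ * (ξ₁ + ξ₂) - W.b₈ := by
  obtain ⟨x₁, y₁, h₁, rfl, rfl⟩ := hP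
  obtain ⟨x₂, y₂, h₂, rfl, rfl⟩ := hQ
  have hx : x₁ ≠ x₂ := fun h => hne (by rw [h])
  obtain ⟨x₃, y₃, h₃, x₄, y₄, h₄, hadd, hsub, hs, hp⟩ := add_sub_some h₁ h₂ hx
  have hu : (C.u : K) ≠ 0 := C.u.ne_zero
  rw [variableChange_b₂, variableChange_b₄, variableChange_b₆, Units.val_inv_eq_inv_val] at hs
  rw [variableChange_b₄, variableChange_b₆, variableChange_b₈, Units.val_inv_eq_inv_val] at hp
  field_simp at hs hp
  refine ⟨_, _, ⟨x₃, y₃, h₃, hadd, rfl⟩, ⟨x₄, y₄, h₄, hsub, rfl⟩, ?_, ?_⟩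
  · linear_combination hs
  · linear_combination hp + C.r * hs

theorem HasX.double (hP : HasX C P ξ)
    (hψ : 4 * ξ ^ 3 + W.b₂ * ξ ^ 2 + 2 * W.b₄ * ξ + W.b₆ ≠ 0) :
    ∃ ξ', HasX C (2 • P) ξ' ∧
      (4 * ξ ^ 3 + W.b₂ * ξ ^ 2 + 2 * W.b₄ * ξ + W.b₆) * ξ' =
        ξ ^ 4 - W.b₄ * ξ ^ 2 - 2 * W.b₆ * ξ - W.b₈ := by
  obtain ⟨x, y, h, rfl, rfl⟩ := hP
  have hu : (C.u : K) ≠ 0 := C.u.ne_zero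
  have key : 4 * x ^ 3 + (C • W).b₂ * x ^ 2 + 2 * (C • W).b₄ * x + (C • W).b₆ =
      (C.u : K)⁻¹ ^ 6 * (4 * (C.u ^ 2 * x + C.r) ^ 3 + W.b₂ * (C.u ^ 2 * x + C.r) ^ 2 +
        2 * W.b₄ * (C.u ^ 2 * x + C.r) + W.b₆) := by
    rw [variableChange_b₂, variableChange_b₄, variableChange_b₆, Units.val_inv_eq_inv_val]
    field_simp
    ring
  obtain ⟨x', y', h', hd, he⟩ := double_some h
    (by rw [key]; exact mul_ne_zero (pow_ne_zero 6 (inv_ne_zero hu)) hψ)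
  refine ⟨_, ⟨x', y', h', hd, rfl⟩, ?_⟩
  rw [variableChange_b₂, variableChange_b₄, variableChange_b₆, variableChange_b₈,
    Units.val_inv_eq_inv_val] at he
  field_simp at he
  linear_combination he
end OriginalX

/-! ### Ultrametric inequalities -/

section Ultrametric
variable {K : Type*} [NormedField K] [IsUltrametricDist K]

theorem norm_add_eq_of_lt {a b : K} (h : ‖b‖ < ‖a‖) : ‖a + b‖ = ‖a‖ := by
  rw [IsUltrametricDist.norm_add_eq_max_of_norm_ne_norm h.ne', max_eq_left h.le]

theorem norm_add_lt_of_lt {a b : K} {c : ℝ} (ha : ‖a‖ < c) (hb : ‖b‖ < c) : ‖a + b‖ < c :=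
  (IsUltrametricDist.norm_add_le_max a b).trans_lt (max_lt ha hb)

theorem norm_sub_lt_of_lt {a b : K} {c : ℝ} (ha : ‖a‖ < c) (hb : ‖b‖ < c) : ‖a - b‖ < c := by
  rw [sub_eq_add_neg]; exact norm_add_lt_of_lt ha (by rwa [norm_neg])

end Ultrametric

/-! ### The subgroup of points that avoid the node -/

section NearNode
variable {K : Type*} [NormedField K] (W : WeierstrassCurve K) (C : VariableChange K)

/-- The point `P` of `C • W` corresponds to a point of `W` whose `x`-coordinate reduces to `0`. If
the reduction of `W` has a node at `(0, 0)`, these are the points that reduce to the node. -/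
def NearNode (P : (C • W).toAffine.Point) : Prop := ∃ ξ, HasX C P ξ ∧ ‖ξ‖ < 1

variable {W C} {P : (C • W).toAffine.Point}

theorem NearNode.neg (h : NearNode W C P) : NearNode W C (-P) :=
  let ⟨ξ, hP, h1⟩ := h
  ⟨ξ, hP.neg, h1⟩

theorem not_nearNode_zero : ¬ NearNode W C 0 := fun ⟨_, h, _⟩ => h.ne_zero rfl

theorem exists_hasX (hP : P ≠ 0) : ∃ ξ, HasX C P ξ := by
  cases P with
  | zero => exact absurd rfl hP
  | some x y h => exact ⟨_, x, y, h, rfl, rfl⟩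

end NearNode

section Components
variable {K : Type*} [NormedField K] [IsUltrametricDist K] {W : WeierstrassCurve K} {τ : ℝ}

/-- The reduction of `W` has a node with `x`-coordinate `0`, and the discriminant has norm `τ`,
expressed by the invariants `bᵢ`, which are all that the formulas for `x`-coordinates involve. -/
structure HasNodeAtOrigin (W : WeierstrassCurve K) (τ : ℝ) : Prop where
  pos : 0 < τ
  lt_one : τ < 1
  b₂ : ‖W.b₂‖ = 1
  b₄ : ‖W.b₄‖ ≤ τ
  b₆ : ‖W.b₆‖ ≤ τ
  b₈ : ‖W.b₈‖ = τ

/-- The numerator of `x(P + Q) x(P - Q)` for two points near the node: the terms `(ξ₁ ξ₂)²` and `b₈`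
dominate, and they do not cancel if their norms differ. -/
theorem HasNodeAtOrigin.norm_prod (hW : HasNodeAtOrigin W τ) {ξ₁ ξ₂ : K} (h₁ : ‖ξ₁‖ < 1)
    (h₂ : ‖ξ₂‖ < 1) (hne : (‖ξ₁‖ * ‖ξ₂‖) ^ 2 ≠ τ) :
    ‖(ξ₁ * ξ₂) ^ 2 - W.b₄ * (ξ₁ * ξ₂) - W.b₆ * (ξ₁ + ξ₂) - W.b₈‖ =
      max ((‖ξ₁‖ * ‖ξ₂‖) ^ 2) τ := by
  have hmain : ‖(ξ₁ * ξ₂) ^ 2 + -W.b₈‖ = max ((‖ξ₁‖ * ‖ξ₂‖) ^ 2) τ := by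
    rw [IsUltrametricDist.norm_add_eq_max_of_norm_ne_norm, norm_neg, hW.b₈, norm_pow, norm_mul]
    rwa [norm_neg, hW.b₈, norm_pow, norm_mul]
  have h12 : ‖ξ₁ * ξ₂‖ < 1 := by
    rw [norm_mul]; exact mul_lt_one_of_nonneg_of_lt_one_left (norm_nonneg _) h₁ h₂.le
  have hsmall : ‖W.b₄ * (ξ₁ * ξ₂) + W.b₆ * (ξ₁ + ξ₂)‖ < τ := by
    refine norm_add_lt_of_lt ?_ ?_
    · rw [norm_mul]
      exact (mul_le_mul_of_nonneg_right hW.b₄ (norm_nonneg _)).trans_lt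
        (mul_lt_of_lt_one_right hW.pos h12)
    · rw [norm_mul]
      exact (mul_le_mul_of_nonneg_right hW.b₆ (norm_nonneg _)).trans_lt
        (mul_lt_of_lt_one_right hW.pos (norm_add_lt_of_lt h₁ h₂))
  rw [show (ξ₁ * ξ₂) ^ 2 - W.b₄ * (ξ₁ * ξ₂) - W.b₆ * (ξ₁ + ξ₂) - W.b₈ =
    ((ξ₁ * ξ₂) ^ 2 + -W.b₈) + -(W.b₄ * (ξ₁ * ξ₂) + W.b₆ * (ξ₁ + ξ₂)) by ring,
    norm_add_eq_of_lt, hmain]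
  rw [norm_neg, hmain]
  exact hsmall.trans_le (le_max_right _ _)

/-- The numerator of `x(P + Q) + x(P - Q)` for two points near the node with `x`-coordinates of the
same norm above `τ ^ (1 / 2)`: the term `b₂ ξ₁ ξ₂` dominates. -/
theorem HasNodeAtOrigin.norm_sum (hW : HasNodeAtOrigin W τ) {ξ₁ ξ₂ : K} (h₁ : ‖ξ₁‖ < 1)
    (heq : ‖ξ₁‖ = ‖ξ₂‖) (hτ : τ < ‖ξ₁‖ ^ 2) :
    ‖2 * (ξ₁ * ξ₂ * (ξ₁ + ξ₂)) + W.b₂ * (ξ₁ * ξ₂) + W.b₄ * (ξ₁ + ξ₂) + W.b₆‖ = ‖ξ₁‖ ^ 2 := by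
  have h12 : ‖ξ₁ * ξ₂‖ = ‖ξ₁‖ ^ 2 := by rw [norm_mul, ← heq, sq]
  have hpos : 0 < ‖ξ₁‖ ^ 2 := hW.pos.trans hτ
  have hadd : ‖ξ₁ + ξ₂‖ < 1 := norm_add_lt_of_lt h₁ (heq ▸ h₁)
  have hmain : ‖W.b₂ * (ξ₁ * ξ₂)‖ = ‖ξ₁‖ ^ 2 := by rw [norm_mul, hW.b₂, one_mul, h12]
  have htwo : ‖(2 : K)‖ ≤ 1 := by exact_mod_cast IsUltrametricDist.norm_natCast_le_one K 2
  rw [show 2 * (ξ₁ * ξ₂ * (ξ₁ + ξ₂)) + W.b₂ * (ξ₁ * ξ₂) + W.b₄ * (ξ₁ + ξ₂) + W.b₆ =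
    W.b₂ * (ξ₁ * ξ₂) + (2 * (ξ₁ * ξ₂ * (ξ₁ + ξ₂)) + W.b₄ * (ξ₁ + ξ₂) + W.b₆) by ring,
    norm_add_eq_of_lt, hmain]
  rw [hmain]
  refine norm_add_lt_of_lt (norm_add_lt_of_lt ?_ ?_) (hW.b₆.trans_lt hτ)
  · rw [norm_mul, norm_mul, h12]
    exact (mul_le_of_le_one_left (by positivity) htwo).trans_lt (mul_lt_of_lt_one_right hpos hadd)
  · rw [norm_mul]
    exact (mul_le_of_le_one_right (norm_nonneg _) hadd.le).trans_lt (hW.b₄.trans_lt hτ)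

variable {C : VariableChange K} [DecidableEq K] {P Q : (C • W).toAffine.Point} {ξ ξ₁ ξ₂ : K}

/-- The norm of `x(2P)` for a point near the node with `‖x(P)‖` above `τ ^ (1 / 2)`. -/
theorem HasX.exists_double (hW : HasNodeAtOrigin W τ) (hP : HasX C P ξ) (h₁ : ‖ξ‖ < 1)
    (hτ : τ < ‖ξ‖ ^ 2) (hne : ‖ξ‖ ^ 4 ≠ τ) :
    ∃ ξ', HasX C (2 • P) ξ' ∧ ‖ξ‖ ^ 2 * ‖ξ'‖ = max (‖ξ‖ ^ 4) τ := by
  have hden := hW.norm_sum h₁ rfl hτ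
  rw [show 2 * (ξ * ξ * (ξ + ξ)) + W.b₂ * (ξ * ξ) + W.b₄ * (ξ + ξ) + W.b₆ =
    4 * ξ ^ 3 + W.b₂ * ξ ^ 2 + 2 * W.b₄ * ξ + W.b₆ by ring] at hden
  have hpow : (‖ξ‖ * ‖ξ‖) ^ 2 = ‖ξ‖ ^ 4 := by ring
  have hnum := hW.norm_prod h₁ h₁ (by rwa [hpow])
  obtain ⟨ξ', hd, he⟩ := hP.double (norm_ne_zero_iff.mp (by
    rw [hden]; exact (hW.pos.trans hτ).ne'))
  refine ⟨ξ', hd, ?_⟩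
  rw [← hden, ← norm_mul, he, ← hpow, ← hnum]
  ring_nf

/-- The norm of `x(P + Q)` for points near the node with `‖x(P)‖ < ‖x(Q)‖`, in terms of the norm of
`x(P - Q)`. -/
theorem HasX.exists_add_of_sub (hW : HasNodeAtOrigin W τ) (hP : HasX C P ξ₁) (hQ : HasX C Q ξ₂)
    (h₂ : ‖ξ₂‖ < 1) (hlt : ‖ξ₁‖ < ‖ξ₂‖) (hne : (‖ξ₁‖ * ‖ξ₂‖) ^ 2 ≠ τ) (hsub : HasX C (P - Q) ξ) :
    ∃ ξ', HasX C (P + Q) ξ' ∧ ‖ξ₂‖ ^ 2 * (‖ξ'‖ * ‖ξ‖) = max ((‖ξ₁‖ * ‖ξ₂‖) ^ 2) τ := by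
  obtain ⟨ξ₃, ξ₄, h₃, h₄, -, hp⟩ := hP.add_sub hQ (fun h => hlt.ne (by rw [h]))
  obtain rfl := h₄.unique hsub
  refine ⟨ξ₃, h₃, ?_⟩
  have hdiff : ‖ξ₁ - ξ₂‖ = ‖ξ₂‖ := by
    rw [← neg_sub, norm_neg, sub_eq_add_neg, norm_add_eq_of_lt (by rwa [norm_neg])]
  rw [← hW.norm_prod (hlt.trans h₂) h₂ hne, ← hp, norm_mul, norm_pow, hdiff, norm_mul]

/-- The points that avoid the node act on the points near the node. The reason is that the sum and
the product of `x(P + Q)` and `x(P - Q)` are both small. -/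
theorem NearNode.add (hW : HasNodeAtOrigin W τ) (hP : NearNode W C P) (hQ : ¬ NearNode W C Q) :
    NearNode W C (P + Q) := by
  obtain ⟨ξ₁, hP, h₁⟩ := hP
  by_cases hQ0 : Q = 0
  · exact ⟨ξ₁, by rwa [hQ0, add_zero], h₁⟩
  obtain ⟨ξ₂, hQX⟩ := exists_hasX (W := W) (C := C) hQ0
  have h₂ : 1 ≤ ‖ξ₂‖ := not_lt.mp fun h => hQ ⟨ξ₂, hQX, h⟩
  have hlt : ‖ξ₁‖ < ‖ξ₂‖ := h₁.trans_le h₂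
  obtain ⟨ξ₃, ξ₄, h₃, h₄, hs, hp⟩ := hP.add_sub hQX (fun h => hlt.ne (by rw [h]))
  have hdiff : ‖ξ₁ - ξ₂‖ = ‖ξ₂‖ := by
    rw [← neg_sub, norm_neg, sub_eq_add_neg, norm_add_eq_of_lt (by rwa [norm_neg])]
  have hadd : ‖ξ₁ + ξ₂‖ = ‖ξ₂‖ := by rw [add_comm, norm_add_eq_of_lt hlt]
  have hsq : ‖ξ₂‖ ≤ ‖ξ₂‖ ^ 2 := le_self_pow₀ h₂ two_ne_zero
  have hpos : 0 < ‖ξ₂‖ := one_pos.trans_le h₂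
  have hτ : τ * ‖ξ₂‖ < ‖ξ₂‖ ^ 2 := (mul_lt_of_lt_one_left hpos hW.lt_one).trans_le hsq
  have h12 : ‖ξ₁ * ξ₂‖ < ‖ξ₂‖ := by
    rw [norm_mul]; exact mul_lt_of_lt_one_left hpos h₁
  have hb₄ : ∀ {z : K}, ‖z‖ ≤ ‖ξ₂‖ → ‖W.b₄ * z‖ < ‖ξ₂‖ ^ 2 := fun hz => by
    rw [norm_mul]
    exact (mul_le_mul hW.b₄ hz (norm_nonneg _) hW.pos.le).trans_lt hτ
  have hb₆ : ‖W.b₆ * (ξ₁ + ξ₂)‖ < ‖ξ₂‖ ^ 2 := by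
    rw [norm_mul]
    exact (mul_le_mul hW.b₆ hadd.le (norm_nonneg _) hW.pos.le).trans_lt hτ
  have hone : (1 : ℝ) ≤ ‖ξ₂‖ ^ 2 := h₂.trans hsq
  have htwo : ‖(2 : K)‖ ≤ 1 := by exact_mod_cast IsUltrametricDist.norm_natCast_le_one K 2
  have hsum : ‖ξ₃ + ξ₄‖ < 1 := by
    have : ‖(ξ₁ - ξ₂) ^ 2 * (ξ₃ + ξ₄)‖ < ‖ξ₂‖ ^ 2 := by
      rw [hs]
      refine norm_add_lt_of_lt (norm_add_lt_of_lt (norm_add_lt_of_lt ?_ ?_) (hb₄ hadd.le))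
        ((hW.b₆.trans_lt hW.lt_one).trans_le hone)
      · rw [norm_mul, norm_mul, hadd]
        refine (mul_le_of_le_one_left (by positivity) htwo).trans_lt ?_
        rw [sq]
        exact mul_lt_mul_of_pos_right h12 hpos
      · rw [norm_mul, hW.b₂, one_mul]
        exact h12.trans_le hsq
    rw [norm_mul, norm_pow, hdiff] at this
    exact (mul_lt_iff_lt_one_right (by positivity)).mp this
  have hprod : ‖ξ₃ * ξ₄‖ < 1 := by
    have : ‖(ξ₁ - ξ₂) ^ 2 * (ξ₃ * ξ₄)‖ < ‖ξ₂‖ ^ 2 := by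
      rw [hp]
      refine norm_sub_lt_of_lt (norm_sub_lt_of_lt (norm_sub_lt_of_lt ?_ (hb₄ h12.le)) hb₆)
        ((hW.b₈.trans_lt hW.lt_one).trans_le hone)
      rw [norm_pow]
      exact pow_lt_pow_left₀ h12 (norm_nonneg _) two_ne_zero
    rw [norm_mul, norm_pow, hdiff] at this
    exact (mul_lt_iff_lt_one_right (by positivity)).mp this
  -- a root of a monic quadratic with small lower coefficients is small
  refine ⟨ξ₃, h₃, ?_⟩
  have hquad : ξ₃ ^ 2 = ξ₃ * (ξ₃ + ξ₄) - ξ₃ * ξ₄ := by ring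
  by_contra! h3
  have hlt3 : ‖ξ₃ * (ξ₃ + ξ₄) - ξ₃ * ξ₄‖ < ‖ξ₃‖ ^ 2 := by
    refine norm_sub_lt_of_lt ?_ (hprod.trans_le (one_le_pow₀ h3))
    rw [norm_mul]
    exact (mul_lt_of_lt_one_right (one_pos.trans_le h3) hsum).trans_le
      (le_self_pow₀ h3 two_ne_zero)
  rw [← hquad, norm_pow] at hlt3
  exact lt_irrefl _ hlt3

/-- If the `x`-coordinates of `P` and `Q` have the same norm above `τ ^ (1 / 2)`, then `P` and `Q`
lie in the same or in opposite components: otherwise `x(P + Q) + x(P - Q)` would be small, whereas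
`(x(P) - x(Q))²` times this sum has norm `‖x(P)‖²`. -/
theorem not_nearNode_add_or_sub (hW : HasNodeAtOrigin W τ) (hP : HasX C P ξ₁) (hQ : HasX C Q ξ₂)
    (h₁ : ‖ξ₁‖ < 1) (heq : ‖ξ₁‖ = ‖ξ₂‖) (hτ : τ < ‖ξ₁‖ ^ 2) :
    ¬ NearNode W C (P + Q) ∨ ¬ NearNode W C (P - Q) := by
  by_cases hne : ξ₁ = ξ₂
  · subst hne
    rcases hP.eq_or_eq_neg hQ with rfl | rfl
    · right; rw [sub_self]; exact not_nearNode_zero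
    · left; rw [neg_add_cancel]; exact not_nearNode_zero
  obtain ⟨ξ₃, ξ₄, h₃, h₄, hs, -⟩ := hP.add_sub hQ hne
  by_contra! hcon
  obtain ⟨⟨_, hx₃, hl₃⟩, ⟨_, hx₄, hl₄⟩⟩ := hcon
  obtain rfl := h₃.unique hx₃
  obtain rfl := h₄.unique hx₄
  have hnorm := congrArg norm hs
  rw [hW.norm_sum h₁ heq hτ, norm_mul, norm_pow] at hnorm
  have hdiff : ‖ξ₁ - ξ₂‖ ≤ ‖ξ₁‖ := by
    rw [sub_eq_add_neg]
    refine (IsUltrametricDist.norm_add_le_max _ _).trans ?_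
    rw [norm_neg, ← heq, max_self]
  have hpos : 0 < ‖ξ₁‖ ^ 2 := hW.pos.trans hτ
  refine lt_irrefl (‖ξ₁‖ ^ 2) ?_
  calc ‖ξ₁‖ ^ 2 = ‖ξ₁ - ξ₂‖ ^ 2 * ‖ξ₃ + ξ₄‖ := hnorm.symm
    _ ≤ ‖ξ₁‖ ^ 2 * ‖ξ₃ + ξ₄‖ := by gcongr
    _ < ‖ξ₁‖ ^ 2 := mul_lt_of_lt_one_right hpos (norm_add_lt_of_lt hl₃ hl₄)

/-- The subgroup of the points of `C • W` that do not reduce to the node. -/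
def awayFromNode (hW : HasNodeAtOrigin W τ) (C : VariableChange K) :
    AddSubgroup (C • W).toAffine.Point where
  carrier := {P | ¬ NearNode W C P}
  zero_mem' := not_nearNode_zero
  neg_mem' := fun {P} h h' => h (by simpa using h'.neg)
  add_mem' := fun {P Q} hP hQ h => hP (by
    simpa using h.add hW (Q := -Q) (fun h' => hQ (by simpa using h'.neg)))

/-- If `‖Δ‖ = ρ ^ ℓ` and some point `P` has `‖x(P)‖ = ρ`, then the class of `P` modulo the points
that avoid the node has order `ℓ`. On the Tate curve whose parameter has norm `ρ ^ ℓ`, a point with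
coordinate of norm `ρ ^ i`, `0 < i < ℓ / 2`, has `‖x‖ = ρ ^ i`; so `‖x(nP)‖ = ρ ^ min n (ℓ - n)` is
expected for `0 < n < ℓ`, and a few of these values are enough. -/
theorem dvd_index_awayFromNode {ℓ : ℕ} (hℓ : ℓ = 5 ∨ ℓ = 7) {ρ : ℝ} (hρ : 0 < ρ) (hρ1 : ρ < 1)
    (hW : HasNodeAtOrigin W (ρ ^ ℓ)) (hP : HasX C P ξ) (hξ : ‖ξ‖ = ρ) :
    ℓ ∣ (awayFromNode hW C).index := by
  have hpow : ∀ {m n : ℕ}, m < n → ρ ^ n < ρ ^ m := fun h => pow_lt_pow_right_of_lt_one₀ hρ hρ1 h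
  have hlt : ∀ {n : ℕ}, n ≠ 0 → ρ ^ n < 1 := fun h => pow_lt_one₀ hρ.le hρ1 h
  have hnear : NearNode W C P := ⟨ξ, hP, hξ ▸ hρ1⟩
  have hℓ4 : 4 < ℓ := by omega
  have hprime : ℓ.Prime := by rcases hℓ with rfl | rfl <;> norm_num
  -- `‖x(2P)‖ = ρ²`
  obtain ⟨ξ₂, hP2, h2⟩ := hP.exists_double hW (hξ ▸ hρ1) (by rw [hξ]; exact hpow (by omega))
    (by rw [hξ]; exact (hpow hℓ4).ne')
  rw [hξ, max_eq_left (hpow hℓ4).le] at h2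
  have hξ₂ : ‖ξ₂‖ = ρ ^ 2 := mul_left_cancel₀ (pow_pos hρ 2).ne' (by rw [h2]; ring)
  -- for `ℓ = 5` and `ℓ = 7`, `‖x(3P)‖` is `ρ²` and `ρ³`, because `(‖x(2P)‖ ‖x(P)‖)² = ρ⁶`
  have h3 := hP2.exists_add_of_sub hW hP (hξ ▸ hρ1)
    (by rw [hξ, hξ₂]; simpa using hpow (show 1 < 2 by norm_num)) (by
      rw [hξ, hξ₂, ← pow_succ, ← pow_mul]
      rcases hℓ with rfl | rfl
      · exact (hpow (by norm_num)).ne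
      · exact (hpow (by norm_num)).ne') (ξ := ξ) (by rwa [two_nsmul, add_sub_cancel_right])
  obtain ⟨ξ₃, hP3, h3⟩ := h3
  rw [hξ, hξ₂, ← pow_succ, ← pow_mul] at h3
  have key : ¬ NearNode W C (ℓ • P) := by
    rcases hℓ with rfl | rfl
    -- `3P` and `2P` lie in the same or in opposite components, and `3P - 2P = P` is near the node
    · rw [max_eq_right (hpow (by norm_num)).le] at h3
      have hξ₃ : ‖ξ₃‖ = ρ ^ 2 := mul_left_cancel₀ (pow_pos hρ 3).ne' (by linear_combination h3)
      rcases not_nearNode_add_or_sub hW hP3 hP2 (hξ₃ ▸ hlt two_ne_zero) (hξ₃.trans hξ₂.symm)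
        (by rw [hξ₃, ← pow_mul]; exact hpow (by norm_num)) with h | h
      · rwa [show 5 • P = 2 • P + P + 2 • P by abel]
      · exact absurd hnear (by rwa [add_sub_cancel_left] at h)
    -- the same argument with `4P` and `3P`
    · rw [max_eq_left (hpow (by norm_num)).le] at h3
      have hξ₃ : ‖ξ₃‖ = ρ ^ 3 := mul_left_cancel₀ (pow_pos hρ 3).ne' (by linear_combination h3)
      obtain ⟨ξ₄, hP4, h4⟩ := hP2.exists_double hW (hξ₂ ▸ hlt two_ne_zero)
        (by rw [hξ₂, ← pow_mul]; exact hpow (by norm_num))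
        (by rw [hξ₂, ← pow_mul]; exact (hpow (by norm_num)).ne)
      rw [hξ₂, ← pow_mul, ← pow_mul, max_eq_right (hpow (by norm_num)).le] at h4
      have hξ₄ : ‖ξ₄‖ = ρ ^ 3 := mul_left_cancel₀ (pow_pos hρ 4).ne' (by linear_combination h4)
      rcases not_nearNode_add_or_sub hW hP4 hP3 (hξ₄ ▸ hlt three_ne_zero) (hξ₄.trans hξ₃.symm)
        (by rw [hξ₄, ← pow_mul]; exact hpow (by norm_num)) with h | h
      · rwa [show 7 • P = 2 • 2 • P + (2 • P + P) by abel]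
      · exact absurd hnear (by rwa [show 2 • 2 • P - (2 • P + P) = P by abel] at h)
  have : Fact ℓ.Prime := ⟨hprime⟩
  have hord :
      addOrderOf (QuotientAddGroup.mk P : (C • W).toAffine.Point ⧸ awayFromNode hW C) = ℓ := by
    refine addOrderOf_eq_prime ?_ ?_
    · rw [← QuotientAddGroup.mk_nsmul, QuotientAddGroup.eq_zero_iff]
      exact key
    · rw [Ne, QuotientAddGroup.eq_zero_iff]
      exact fun h => h hnear
  exact hord.symm.dvd.trans (addOrderOf_dvd_natCard _)

end Components

/-! ### Minimal models over a discrete valuation ring -/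

section DVR
variable (R : Type*) [CommRing R] [IsDomain R] [IsDiscreteValuationRing R]
  {K : Type*} [Field K] [Algebra R K] [IsFractionRing R K]

open IsDiscreteValuationRing IsDedekindDomain.HeightOneSpectrum in
theorem valuation_Δ_le_of_isMinimal (W : WeierstrassCurve K) [hW : W.IsIntegral R]
    (C : VariableChange K) [hC : (C • W).IsMinimal R] :
    (maximalIdeal R).valuation K W.Δ ≤ (maximalIdeal R).valuation K (C • W).Δ := by
  have hmax := hC.val_Δ_maximal.2 (j := C⁻¹)
  simp only [inv_smul_smul, one_smul] at hmax
  rcases le_total (valuation_Δ_aux R (C • W)) (valuation_Δ_aux R W) with hle | hle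
  · have := hmax hW hle
    rw [← valuation_Δ_aux_eq_of_isIntegral, ← valuation_Δ_aux_eq_of_isIntegral]
    exact this
  · rw [← valuation_Δ_aux_eq_of_isIntegral, ← valuation_Δ_aux_eq_of_isIntegral]
    exact hle

open IsDiscreteValuationRing IsDedekindDomain.HeightOneSpectrum in
/-- A change of variables from an integral to a minimal model has an integral scaling factor `u`. -/
theorem exists_algebraMap_eq_u_of_isMinimal (W : WeierstrassCurve K) [W.IsIntegral R]
    (hΔ : W.Δ ≠ 0) (C : VariableChange K) [(C • W).IsMinimal R] :
    ∃ r : R, algebraMap R K r = C.u := by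
  refine exists_lift_of_le_one ?_
  have h := valuation_Δ_le_of_isMinimal R W C
  have hu : (maximalIdeal R).valuation K (C.u : K) ≠ 0 := by simp
  rw [variableChange_Δ, Units.val_inv_eq_inv_val, map_mul, map_pow, map_inv₀] at h
  have hΔ' : 0 < (maximalIdeal R).valuation K W.Δ := by
    rw [zero_lt_iff]; simpa using hΔ
  have h1 : 1 ≤ ((maximalIdeal R).valuation K (C.u : K))⁻¹ ^ 12 :=
    le_of_mul_le_mul_right (by rwa [one_mul]) hΔ'
  rw [inv_pow, one_le_inv₀ (pow_pos (zero_lt_iff.mpr hu) 12)] at h1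
  exact (pow_le_one_iff (by norm_num)).mp h1

omit [IsDomain R] [IsDiscreteValuationRing R] in
theorem equation_of_algebraMap {W : WeierstrassCurve K} [W.IsIntegral R] {x₀ y₀ : R}
    (h : W.toAffine.Equation (algebraMap R K x₀) (algebraMap R K y₀)) :
    (W.integralModel R).toAffine.Equation x₀ y₀ := by
  rw [← baseChange_integralModel_eq R W] at h
  exact (Affine.map_equation (integralModel R W) (IsFractionRing.injective R K) x₀ y₀).mp h

open IsDiscreteValuationRing IsDedekindDomain.HeightOneSpectrum in
/-- Good reduction: if an integral model has a unit discriminant, then every point has nonsingular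
reduction. -/
theorem componentIndex_eq_one (W : WeierstrassCurve K) [W.IsIntegral R] {d : R} (hd : IsUnit d)
    (hΔ : algebraMap R K d = W.Δ) : componentIndex R W = 1 := by
  obtain ⟨C, hC⟩ : ∃ C : VariableChange K, W.minimal R = C • W := ⟨_, rfl⟩
  have hmin : (C • W).IsMinimal R := hC ▸ inferInstance
  have hgood : (W.minimal R).HasGoodReduction R := by
    refine ⟨le_antisymm ?_ ?_⟩
    · rw [← integralModel_Δ_eq R]; exact valuation_le_one _ _
    · rw [hC]
      refine le_trans ?_ (valuation_Δ_le_of_isMinimal R W C)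
      rw [← hΔ]
      exact ((valuation_eq_one_iff_notMem _).mpr (by simpa [maximalIdeal] using hd)).ge
  have hell := (hasGoodReduction_iff_isElliptic_reduction R).mp hgood
  classical
  rw [componentIndex, nonsingularReductionSubgroup, AddSubgroup.index_eq_one, eq_top_iff]
  rintro P -
  refine AddSubgroup.subset_closure ?_
  cases P with
  | zero => trivial
  | some x y h =>
    rintro x₀ y₀ rfl rfl
    exact Affine.equation_iff_nonsingular.mp ((equation_of_algebraMap R h.1).map _)

end DVR

/-! ### Equations with a node at the origin and their changes of variables -/

section Norms
variable {K : Type*} [NormedField K] [IsUltrametricDist K]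

theorem norm_add_le_of_le_of_le {a b : K} {c : ℝ} (ha : ‖a‖ ≤ c) (hb : ‖b‖ ≤ c) : ‖a + b‖ ≤ c :=
  (IsUltrametricDist.norm_add_le_max a b).trans (max_le ha hb)

omit [IsUltrametricDist K] in
theorem norm_mul_le_of_le_one {a b : K} {c : ℝ} (ha : ‖a‖ ≤ 1) (hb : ‖b‖ ≤ c) : ‖a * b‖ ≤ c := by
  rw [norm_mul]
  exact (mul_le_of_le_one_left (norm_nonneg _) ha).trans hb

theorem norm_ofNat_le_one (n : ℕ) [n.AtLeastTwo] : ‖(OfNat.ofNat n : K)‖ ≤ 1 :=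
  IsUltrametricDist.norm_natCast_le_one K n

theorem norm_le_one_of_sq {z b c : K} (hb : ‖b‖ ≤ 1) (hc : ‖c‖ ≤ 1) (h : z ^ 2 + b * z = c) :
    ‖z‖ ≤ 1 := by
  by_contra! hz
  have hz0 : 0 < ‖z‖ := one_pos.trans hz
  have hlt : ‖-(b * z) + c‖ ≤ ‖z‖ := by
    refine norm_add_le_of_le_of_le ?_ (hc.trans hz.le)
    rw [norm_neg]
    exact norm_mul_le_of_le_one hb le_rfl
  rw [← h, neg_add_cancel_comm_assoc, norm_pow, sq] at hlt
  exact (lt_mul_of_one_lt_right hz0 hz).not_ge hlt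

theorem norm_lt_one_of_sq {z b c : K} (hb : ‖b‖ < 1) (hc : ‖c‖ < 1) (h : z ^ 2 + b * z = c) :
    ‖z‖ < 1 := by
  by_contra! hz
  have hz0 : 0 < ‖z‖ := one_pos.trans_le hz
  have hlt : ‖-(b * z) + c‖ < ‖z‖ := by
    refine norm_add_lt_of_lt ?_ (hc.trans_le hz)
    rw [norm_neg, norm_mul]
    exact mul_lt_of_lt_one_left hz0 hb
  rw [← h, neg_add_cancel_comm_assoc, norm_pow, sq] at hlt
  exact (le_mul_of_one_le_right hz0.le hz).not_gt hlt

/-- A Weierstrass equation of the shape to which Tate's algorithm brings a curve with split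
multiplicative reduction: the reduction is `y² + a₁xy = x³` with `a₁` a unit, and `τ = ‖a₆‖` is the
norm of the discriminant. -/
structure IsTateForm (W : WeierstrassCurve K) (τ : ℝ) : Prop where
  pos : 0 < τ
  lt_one : τ < 1
  a₁ : ‖W.a₁‖ = 1
  a₂ : ‖W.a₂‖ ≤ τ
  a₃ : ‖W.a₃‖ ≤ τ
  a₄ : ‖W.a₄‖ ≤ τ
  a₆ : ‖W.a₆‖ = τ

variable {W : WeierstrassCurve K} {τ : ℝ}

theorem IsTateForm.hasNodeAtOrigin (h : IsTateForm W τ) : HasNodeAtOrigin W τ := by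
  have hττ : τ * τ < τ := mul_lt_of_lt_one_left h.pos h.lt_one
  have mul_lt : ∀ {a b : K}, ‖a‖ ≤ τ → ‖b‖ ≤ τ → ‖a * b‖ < τ := fun ha hb => by
    rw [norm_mul]; exact (mul_le_mul ha hb (norm_nonneg _) h.pos.le).trans_lt hττ
  refine ⟨h.pos, h.lt_one, ?_, ?_, ?_, ?_⟩
  · rw [WeierstrassCurve.b₂, norm_add_eq_of_lt, norm_pow, h.a₁, one_pow]
    rw [norm_pow, h.a₁, one_pow]
    exact (norm_mul_le_of_le_one (norm_ofNat_le_one 4) h.a₂).trans_lt h.lt_one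
  · exact norm_add_le_of_le_of_le (norm_mul_le_of_le_one (norm_ofNat_le_one 2) h.a₄)
      (norm_mul_le_of_le_one h.a₁.le h.a₃)
  · refine norm_add_le_of_le_of_le ?_ (norm_mul_le_of_le_one (norm_ofNat_le_one 4) h.a₆.le)
    rw [sq]
    exact (mul_lt h.a₃ h.a₃).le
  · have hmain : ‖W.a₁ ^ 2 * W.a₆‖ = τ := by rw [norm_mul, norm_pow, h.a₁, one_pow, one_mul, h.a₆]
    rw [WeierstrassCurve.b₈, show W.a₁ ^ 2 * W.a₆ + 4 * W.a₂ * W.a₆ - W.a₁ * W.a₃ * W.a₄ +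
      W.a₂ * W.a₃ ^ 2 - W.a₄ ^ 2 = W.a₁ ^ 2 * W.a₆ + ((4 * W.a₂) * W.a₆ - (W.a₁ * W.a₃) * W.a₄ +
      W.a₂ * W.a₃ * W.a₃ - W.a₄ * W.a₄) by ring, norm_add_eq_of_lt, hmain]
    rw [hmain]
    refine norm_sub_lt_of_lt (norm_add_lt_of_lt (norm_sub_lt_of_lt ?_ ?_) ?_) (mul_lt h.a₄ h.a₄)
    · exact mul_lt (norm_mul_le_of_le_one (norm_ofNat_le_one 4) h.a₂) h.a₆.le
    · exact mul_lt (norm_mul_le_of_le_one h.a₁.le h.a₃) h.a₄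
    · exact mul_lt (mul_lt h.a₂ h.a₃).le h.a₃

theorem HasNodeAtOrigin.norm_c₄ (h : HasNodeAtOrigin W τ) : ‖W.c₄‖ = 1 := by
  have hmain : ‖W.b₂ ^ 2‖ = 1 := by rw [norm_pow, h.b₂, one_pow]
  rw [WeierstrassCurve.c₄, sub_eq_add_neg, norm_add_eq_of_lt, hmain]
  rw [hmain, norm_neg]
  exact (norm_mul_le_of_le_one (norm_ofNat_le_one 24) h.b₄).trans_lt h.lt_one

theorem HasNodeAtOrigin.norm_Δ (h : HasNodeAtOrigin W τ) : ‖W.Δ‖ = τ := by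
  have hττ : τ * τ < τ := mul_lt_of_lt_one_left h.pos h.lt_one
  have mul_lt : ∀ {a b : K}, ‖a‖ ≤ τ → ‖b‖ ≤ τ → ‖a * b‖ < τ := fun ha hb => by
    rw [norm_mul]; exact (mul_le_mul ha hb (norm_nonneg _) h.pos.le).trans_lt hττ
  have hmain : ‖-W.b₂ ^ 2 * W.b₈‖ = τ := by
    rw [norm_mul, norm_neg, norm_pow, h.b₂, one_pow, one_mul, h.b₈]
  rw [WeierstrassCurve.Δ, show -W.b₂ ^ 2 * W.b₈ - 8 * W.b₄ ^ 3 - 27 * W.b₆ ^ 2 +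
    9 * W.b₂ * W.b₄ * W.b₆ = -W.b₂ ^ 2 * W.b₈ + (9 * (W.b₂ * W.b₄) * W.b₆ -
      8 * W.b₄ * W.b₄ * W.b₄ - 27 * W.b₆ * W.b₆) by ring, norm_add_eq_of_lt, hmain]
  rw [hmain]
  have h84 : ‖8 * W.b₄‖ ≤ τ := norm_mul_le_of_le_one (norm_ofNat_le_one 8) h.b₄
  refine norm_sub_lt_of_lt (norm_sub_lt_of_lt ?_ ?_) ?_
  · exact mul_lt (norm_mul_le_of_le_one (norm_ofNat_le_one 9)
      (norm_mul_le_of_le_one h.b₂.le h.b₄)) h.b₆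
  · exact mul_lt (mul_lt h84 h.b₄).le h.b₄
  · exact mul_lt (norm_mul_le_of_le_one (norm_ofNat_le_one 27) h.b₆) h.b₆

/-- The translation `r` of a change of variables between integral models with `‖u‖ = 1` is integral:
the relations for `b₆` and `b₈` combine to a monic quartic equation for `r` with integral
coefficients. -/
theorem norm_r_le_one {C : VariableChange K} (hu : ‖(C.u : K)‖ = 1) (h₄ : ‖W.b₄‖ ≤ 1)
    (h₆ : ‖W.b₆‖ ≤ 1) (h₈ : ‖W.b₈‖ ≤ 1) (h₆' : ‖(C • W).b₆‖ ≤ 1) (h₈' : ‖(C • W).b₈‖ ≤ 1) :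
    ‖C.r‖ ≤ 1 := by
  by_contra! hr
  have hr0 : 0 < ‖C.r‖ := one_pos.trans hr
  have hu0 : (C.u : K) ≠ 0 := C.u.ne_zero
  have key : C.r ^ 2 * C.r ^ 2 = C.u ^ 6 * (C • W).b₆ * C.r - C.u ^ 8 * (C • W).b₈ +
      C.r ^ 2 * W.b₄ + 2 * (W.b₆ * C.r) + W.b₈ := by
    rw [variableChange_b₆, variableChange_b₈, Units.val_inv_eq_inv_val]
    field_simp
    ring
  have h1 : (1 : ℝ) ≤ ‖C.r‖ ^ 2 := one_le_pow₀ hr.le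
  have hle : ‖C.r‖ ≤ ‖C.r‖ ^ 2 := le_self_pow₀ hr.le two_ne_zero
  have hbound : ‖C.r ^ 2 * C.r ^ 2‖ ≤ ‖C.r‖ ^ 2 := by
    rw [key, sub_eq_add_neg]
    refine norm_add_le_of_le_of_le (norm_add_le_of_le_of_le (norm_add_le_of_le_of_le
      (norm_add_le_of_le_of_le ?_ ?_) ?_) ?_) (h₈.trans h1)
    · rw [norm_mul, norm_mul, norm_pow, hu, one_pow, one_mul]
      exact (mul_le_of_le_one_left (norm_nonneg _) h₆').trans hle
    · rw [norm_neg, norm_mul, norm_pow, hu, one_pow, one_mul]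
      exact h₈'.trans h1
    · rw [norm_mul, norm_pow]
      exact mul_le_of_le_one_right (by positivity) h₄
    · exact norm_mul_le_of_le_one (norm_ofNat_le_one 2) (norm_mul_le_of_le_one h₆ hle)
  rw [norm_mul, norm_pow] at hbound
  have : 1 < ‖C.r‖ ^ 2 := one_lt_pow₀ hr two_ne_zero
  exact (lt_mul_of_one_lt_right (by positivity) this).not_ge hbound

theorem norm_s_le_one {C : VariableChange K} (hu : ‖(C.u : K)‖ = 1) (hr : ‖C.r‖ ≤ 1)
    (h₁ : ‖W.a₁‖ ≤ 1) (h₂ : ‖W.a₂‖ ≤ 1) (h₂' : ‖(C • W).a₂‖ ≤ 1) : ‖C.s‖ ≤ 1 := by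
  have hu0 : (C.u : K) ≠ 0 := C.u.ne_zero
  refine norm_le_one_of_sq (b := W.a₁) (c := W.a₂ + 3 * C.r + -(C.u ^ 2 * (C • W).a₂)) h₁ ?_ ?_
  · refine norm_add_le_of_le_of_le (norm_add_le_of_le_of_le h₂
      (norm_mul_le_of_le_one (norm_ofNat_le_one 3) hr)) ?_
    rw [norm_neg, norm_mul, norm_pow, hu, one_pow, one_mul]
    exact h₂'
  · rw [variableChange_a₂, Units.val_inv_eq_inv_val]
    field_simp
    ring

end Norms

/-! ### Component groups over `ℚ_p` -/

section Padic
variable {p : ℕ} [Fact p.Prime]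

theorem norm_algebraMap_le_one (x : ℤ_[p]) : ‖algebraMap ℤ_[p] ℚ_[p] x‖ ≤ 1 := x.norm_le_one

theorem residue_eq_zero_of_norm_lt_one {x : ℤ_[p]} (h : ‖algebraMap ℤ_[p] ℚ_[p] x‖ < 1) :
    IsLocalRing.residue ℤ_[p] x = 0 := by
  rw [IsLocalRing.residue_eq_zero_iff, IsLocalRing.mem_maximalIdeal, PadicInt.mem_nonunits]
  exact h

/-- Hensel's lemma at the simple root `0` of the reduced polynomial `z² + bz`. -/
theorem exists_root_of_norm {b c : ℚ_[p]} (hb : ‖b‖ = 1) (hc : ‖c‖ < 1) :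
    ∃ z : ℚ_[p], z ^ 2 + b * z = c := by
  obtain ⟨b, rfl⟩ : ∃ b₀ : ℤ_[p], (b₀ : ℚ_[p]) = b := ⟨⟨b, hb.le⟩, rfl⟩
  obtain ⟨c, rfl⟩ : ∃ c₀ : ℤ_[p], (c₀ : ℚ_[p]) = c := ⟨⟨c, hc.le⟩, rfl⟩
  rw [PadicInt.padic_norm_e_of_padicInt] at hb hc
  open Polynomial in
  obtain ⟨z, hz, -⟩ := hensels_lemma (p := p) (R := ℤ_[p]) (F := X ^ 2 + C b * X - C c) (a := 0)
    (by simp [hb, hc])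
  refine ⟨z, ?_⟩
  simp only [Polynomial.aeval_X, map_sub, map_add, map_mul, map_pow, Polynomial.aeval_C,
    Algebra.algebraMap_self, RingHom.id_apply] at hz
  rw [← sub_eq_zero.mp hz]
  push_cast
  ring

variable {W : WeierstrassCurve ℚ_[p]}

theorem isIntegral_of_norm_le_one (h₁ : ‖W.a₁‖ ≤ 1) (h₂ : ‖W.a₂‖ ≤ 1) (h₃ : ‖W.a₃‖ ≤ 1)
    (h₄ : ‖W.a₄‖ ≤ 1) (h₆ : ‖W.a₆‖ ≤ 1) : W.IsIntegral ℤ_[p] :=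
  isIntegral_of_exists_lift ℤ_[p] ⟨⟨_, h₁⟩, rfl⟩ ⟨⟨_, h₂⟩, rfl⟩ ⟨⟨_, h₃⟩, rfl⟩ ⟨⟨_, h₄⟩, rfl⟩
    ⟨⟨_, h₆⟩, rfl⟩

variable {C : VariableChange ℚ_[p]} {τ : ℝ}

/-- A point near the node has singular reduction on a minimal model `C • W`: both partial
derivatives of the equation are small at the corresponding point `(ξ, η)` of `W`, and a change of
variables with `‖u‖ = 1` and `s` integral transforms them by an integral triangular matrix. -/
theorem IsTateForm.not_hasNonsingularReduction (hW : IsTateForm W τ) [(C • W).IsMinimal ℤ_[p]]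
    (hu : ‖(C.u : ℚ_[p])‖ = 1) {P : (C • W).toAffine.Point} (hP : NearNode W C P) :
    ¬ HasNonsingularReduction ℤ_[p] (C • W) P := by
  obtain ⟨ξ, ⟨x, y, h, rfl, rfl⟩, hξ⟩ := hP
  set I := integralModel ℤ_[p] (C • W) with hI
  have hu0 : (C.u : ℚ_[p]) ≠ 0 := C.u.ne_zero
  have hN := hW.hasNodeAtOrigin
  have hτ := hW.lt_one.le
  have hr : ‖C.r‖ ≤ 1 := by
    refine norm_r_le_one hu (hN.b₄.trans hτ) (hN.b₆.trans hτ) (hN.b₈.le.trans hτ) ?_ ?_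
    · rw [← integralModel_b₆_eq ℤ_[p]]; exact norm_algebraMap_le_one _
    · rw [← integralModel_b₈_eq ℤ_[p]]; exact norm_algebraMap_le_one _
  have hs : ‖C.s‖ ≤ 1 := by
    refine norm_s_le_one hu hr hW.a₁.le (hW.a₂.trans hτ) ?_
    rw [← integralModel_a₂_eq ℤ_[p]]; exact norm_algebraMap_le_one _
  have hx : ‖x‖ ≤ 1 := by
    have : ‖(C.u : ℚ_[p]) ^ 2 * x‖ ≤ 1 := by
      rw [show (C.u : ℚ_[p]) ^ 2 * x = C.u ^ 2 * x + C.r + -C.r by ring]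
      exact norm_add_le_of_le_of_le hξ.le (by rwa [norm_neg])
    rwa [norm_mul, norm_pow, hu, one_pow, one_mul] at this
  have heq := ((C • W).toAffine.equation_iff x y).mp h.1
  have hy : ‖y‖ ≤ 1 := by
    obtain ⟨x₀, rfl⟩ : ∃ x₀ : ℤ_[p], algebraMap ℤ_[p] ℚ_[p] x₀ = x := ⟨⟨x, hx⟩, rfl⟩
    have h₁ := (integralModel_a₁_eq ℤ_[p] (C • W)).symm
    have h₂ := (integralModel_a₂_eq ℤ_[p] (C • W)).symm
    have h₃ := (integralModel_a₃_eq ℤ_[p] (C • W)).symm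
    have h₄ := (integralModel_a₄_eq ℤ_[p] (C • W)).symm
    have h₆ := (integralModel_a₆_eq ℤ_[p] (C • W)).symm
    refine norm_le_one_of_sq (b := algebraMap ℤ_[p] ℚ_[p] (I.a₁ * x₀ + I.a₃))
      (c := algebraMap ℤ_[p] ℚ_[p] (x₀ ^ 3 + I.a₂ * x₀ ^ 2 + I.a₄ * x₀ + I.a₆))
      (norm_algebraMap_le_one _) (norm_algebraMap_le_one _) ?_
    simp only [map_add, map_mul, map_pow]
    rw [h₁, h₂, h₃, h₄, h₆] at heq
    linear_combination heq
  obtain ⟨x₀, rfl⟩ : ∃ x₀ : ℤ_[p], algebraMap ℤ_[p] ℚ_[p] x₀ = x := ⟨⟨x, hx⟩, rfl⟩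
  obtain ⟨y₀, rfl⟩ : ∃ y₀ : ℤ_[p], algebraMap ℤ_[p] ℚ_[p] y₀ = y := ⟨⟨y, hy⟩, rfl⟩
  set x := algebraMap ℤ_[p] ℚ_[p] x₀
  set y := algebraMap ℤ_[p] ℚ_[p] y₀
  -- the corresponding point of `W`
  set ξ : ℚ_[p] := C.u ^ 2 * x + C.r with hξdef
  obtain ⟨η, hη⟩ : ∃ η : ℚ_[p], η = C.u ^ 3 * y + C.u ^ 2 * C.s * x + C.t := ⟨_, rfl⟩
  have heqW : η ^ 2 + (W.a₁ * ξ + W.a₃) * η = ξ ^ 3 + W.a₂ * ξ ^ 2 + W.a₄ * ξ + W.a₆ := by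
    rw [variableChange_def] at heq
    simp only [Units.val_inv_eq_inv_val] at heq
    field_simp at heq
    rw [hη, hξdef]
    linear_combination heq
  have h₂ := hW.a₂.trans_lt hW.lt_one
  have h₃ := hW.a₃.trans_lt hW.lt_one
  have h₄ := hW.a₄.trans_lt hW.lt_one
  have h₆ := hW.a₆.trans_lt hW.lt_one
  have mul_lt : ∀ {a b : ℚ_[p]}, ‖a‖ ≤ 1 → ‖b‖ < 1 → ‖a * b‖ < 1 := fun ha hb =>
    (norm_mul_le_of_le_one ha le_rfl).trans_lt hb
  have hηn : ‖η‖ < 1 := by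
    refine norm_lt_one_of_sq (norm_add_lt_of_lt (mul_lt hW.a₁.le hξ) h₃) ?_ heqW
    refine norm_add_lt_of_lt (norm_add_lt_of_lt (norm_add_lt_of_lt ?_ ?_) ?_) h₆
    · rw [norm_pow]; exact pow_lt_one₀ (norm_nonneg _) hξ three_ne_zero
    · rw [sq]; exact mul_lt h₂.le (mul_lt hξ.le hξ)
    · exact mul_lt h₄.le hξ
  have hF : ‖W.a₁ * η - (3 * ξ * ξ + 2 * W.a₂ * ξ + W.a₄)‖ < 1 := by
    refine norm_sub_lt_of_lt (mul_lt hW.a₁.le hηn)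
      (norm_add_lt_of_lt (norm_add_lt_of_lt ?_ ?_) h₄)
    · exact mul_lt (norm_mul_le_of_le_one (norm_ofNat_le_one 3) hξ.le) hξ
    · exact mul_lt (norm_mul_le_of_le_one (norm_ofNat_le_one 2) h₂.le) hξ
  have hG : ‖2 * η + W.a₁ * ξ + W.a₃‖ < 1 :=
    norm_add_lt_of_lt (norm_add_lt_of_lt (mul_lt (norm_ofNat_le_one 2) hηn)
      (mul_lt hW.a₁.le hξ)) h₃
  have hX : ‖(C • W).a₁ * y - (3 * x ^ 2 + 2 * (C • W).a₂ * x + (C • W).a₄)‖ < 1 := by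
    have : (C.u : ℚ_[p]) ^ 4 * ((C • W).a₁ * y - (3 * x ^ 2 + 2 * (C • W).a₂ * x + (C • W).a₄)) =
        W.a₁ * η - (3 * ξ * ξ + 2 * W.a₂ * ξ + W.a₄) + C.s * (2 * η + W.a₁ * ξ + W.a₃) := by
      rw [variableChange_a₁, variableChange_a₂, variableChange_a₄, Units.val_inv_eq_inv_val, hη,
        hξdef]
      field_simp
      ring
    have hlt := norm_add_lt_of_lt hF (mul_lt hs hG)
    rwa [← this, norm_mul, norm_pow, hu, one_pow, one_mul] at hlt
  have hY : ‖2 * y + (C • W).a₁ * x + (C • W).a₃‖ < 1 := by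
    have : (C.u : ℚ_[p]) ^ 3 * (2 * y + (C • W).a₁ * x + (C • W).a₃) =
        2 * η + W.a₁ * ξ + W.a₃ := by
      rw [variableChange_a₁, variableChange_a₃, Units.val_inv_eq_inv_val, hη, hξdef]
      field_simp
      ring
    rwa [← this, norm_mul, norm_pow, hu, one_pow, one_mul] at hG
  intro hns
  have hns := ((C • W).reduction ℤ_[p]).toAffine.nonsingular_iff' _ _ |>.mp (hns x₀ y₀ rfl rfl)
  have hredX : IsLocalRing.residue ℤ_[p] (I.a₁ * y₀ - (3 * x₀ ^ 2 + 2 * I.a₂ * x₀ + I.a₄)) = 0 := by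
    apply residue_eq_zero_of_norm_lt_one
    simp only [map_sub, map_add, map_mul, map_pow, map_ofNat, hI, integralModel_a₁_eq,
      integralModel_a₂_eq, integralModel_a₄_eq]
    exact hX
  have hredY : IsLocalRing.residue ℤ_[p] (2 * y₀ + I.a₁ * x₀ + I.a₃) = 0 := by
    apply residue_eq_zero_of_norm_lt_one
    simp only [map_add, map_mul, map_ofNat, hI, integralModel_a₁_eq, integralModel_a₃_eq]
    exact hY
  simp only [map_sub, map_add, map_mul, map_pow, map_ofNat] at hredX hredY
  exact hns.2.elim (fun h => h hredX) (fun h => h hredY)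

/-- If `‖Δ‖ = ‖ϖ‖ ^ ℓ` with `ℓ > 2`, there is a point with `x`-coordinate `ϖ`: the substitution
`y = ϖz` turns the equation into a quadratic for `z` with a simple root `0` modulo `p`. -/
theorem IsTateForm.exists_hasX (hΔ : W.Δ ≠ 0) {ϖ : ℚ_[p]} (h0 : ϖ ≠ 0) (h1 : ‖ϖ‖ < 1) {ℓ : ℕ}
    (hℓ : 2 < ℓ) (hW : IsTateForm W (‖ϖ‖ ^ ℓ)) (C : VariableChange ℚ_[p]) :
    ∃ P : (C • W).toAffine.Point, HasX C P ϖ := by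
  have hpos : 0 < ‖ϖ‖ := norm_pos_iff.mpr h0
  have hdiv : ∀ {a : ℚ_[p]} (n : ℕ), n < ℓ → ‖a‖ ≤ ‖ϖ‖ ^ ℓ → ‖a / ϖ ^ n‖ < 1 := fun n hn ha => by
    rw [norm_div, norm_pow, div_lt_one (pow_pos hpos n)]
    exact ha.trans_lt (pow_lt_pow_right_of_lt_one₀ hpos h1 hn)
  obtain ⟨z, hz⟩ := exists_root_of_norm (b := W.a₁ + W.a₃ / ϖ ^ 1)
    (c := ϖ + W.a₂ + W.a₄ / ϖ ^ 1 + W.a₆ / ϖ ^ 2)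
    (by
      rw [norm_add_eq_of_lt, hW.a₁]
      rw [hW.a₁]
      exact hdiv 1 (by omega) hW.a₃)
    (norm_add_lt_of_lt (norm_add_lt_of_lt (norm_add_lt_of_lt h1 (hW.a₂.trans_lt hW.lt_one))
      (hdiv 1 (by omega) hW.a₄)) (hdiv 2 hℓ hW.a₆.le))
  have hu0 : (C.u : ℚ_[p]) ≠ 0 := C.u.ne_zero
  have heq : (C • W).toAffine.Equation ((ϖ - C.r) / C.u ^ 2)
      ((ϖ * z - C.s * (ϖ - C.r) - C.t) / C.u ^ 3) := by
    rw [Affine.equation_iff, variableChange_def]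
    simp only [Units.val_inv_eq_inv_val]
    field_simp at hz ⊢
    linear_combination hz
  have hΔ' : (C • W).Δ ≠ 0 := by
    rw [variableChange_Δ]
    exact mul_ne_zero (pow_ne_zero 12 C.u⁻¹.ne_zero) hΔ
  refine ⟨.some _ _ ((Affine.equation_iff_nonsingular_of_Δ_ne_zero hΔ').mp heq), _, _, _, rfl, ?_⟩
  field_simp
  ring

/-- The passage from an equation of Tate's form to the chosen minimal model. Such an equation is
itself minimal because `c₄` is a unit, and hence `‖u‖ = 1`. -/
theorem IsTateForm.dvd_componentIndex {ℓ : ℕ} (hℓ : ℓ = 5 ∨ ℓ = 7) {ϖ : ℚ_[p]} (h0 : ϖ ≠ 0)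
    (h1 : ‖ϖ‖ < 1) (hW : IsTateForm W (‖ϖ‖ ^ ℓ)) : ℓ ∣ componentIndex ℤ_[p] W := by
  have hN := hW.hasNodeAtOrigin
  have hτ := hW.lt_one.le
  have hint : W.IsIntegral ℤ_[p] := isIntegral_of_norm_le_one hW.a₁.le (hW.a₂.trans hτ)
    (hW.a₃.trans hτ) (hW.a₄.trans hτ) (hW.a₆.le.trans hτ)
  have hΔ : W.Δ ≠ 0 := norm_pos_iff.mp (hN.norm_Δ ▸ hN.pos)
  classical
  obtain ⟨C, hC⟩ : ∃ C : VariableChange ℚ_[p], W.minimal ℤ_[p] = C • W := ⟨_, rfl⟩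
  have hmin : (C • W).IsMinimal ℤ_[p] := hC ▸ inferInstance
  have hu : ‖(C.u : ℚ_[p])‖ = 1 := by
    refine le_antisymm ?_ ?_
    -- minimality of `C • W` bounds `u` from above, integrality of its `c₄` from below
    · obtain ⟨u₀, hu₀⟩ := exists_algebraMap_eq_u_of_isMinimal ℤ_[p] W hΔ C
      rw [← hu₀]
      exact norm_algebraMap_le_one _
    · have hc : ‖(C • W).c₄‖ ≤ 1 := by
        rw [← integralModel_c₄_eq ℤ_[p]]; exact norm_algebraMap_le_one _
      rw [variableChange_c₄, norm_mul, hN.norm_c₄, mul_one, norm_pow, Units.val_inv_eq_inv_val,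
        norm_inv, inv_pow, inv_le_one₀ (pow_pos (norm_pos_iff.mpr C.u.ne_zero) 4)] at hc
      exact (one_le_pow_iff_of_nonneg (norm_nonneg _) four_ne_zero).mp hc
  obtain ⟨P, hP⟩ := hW.exists_hasX hΔ h0 h1 (by omega) C
  have hdvd := dvd_index_awayFromNode hℓ (norm_pos_iff.mpr h0) h1 hN hP rfl
  have hle : nonsingularReductionSubgroup ℤ_[p] (C • W) ≤ awayFromNode hN C := by
    rw [nonsingularReductionSubgroup, AddSubgroup.closure_le]
    exact fun Q hQ hnear => hW.not_hasNonsingularReduction hu hnear hQ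
  have : ℓ ∣ (nonsingularReductionSubgroup ℤ_[p] (C • W)).index :=
    hdvd.trans (AddSubgroup.index_dvd_of_le hle)
  -- the model `W.minimal` is replaced by `C • W` together with the instance that it is minimal
  suffices h : ∀ (W' : WeierstrassCurve ℚ_[p]) (_ : W'.IsMinimal ℤ_[p]), W' = C • W →
      ℓ ∣ (nonsingularReductionSubgroup ℤ_[p] W').index from h _ inferInstance hC
  rintro _ _ rfl
  exact this

end Padic

/-! ### The global Tamagawa number -/

section Global

theorem map_intCast_map_padic (W : WeierstrassCurve ℤ) (p : ℕ) [Fact p.Prime] :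
    (W.map (Int.castRingHom ℚ)).map (algebraMap ℚ ℚ_[p]) =
      (W.map (Int.castRingHom ℤ_[p])).map (algebraMap ℤ_[p] ℚ_[p]) := by
  rw [map_map, map_map]
  congr 1

theorem localTamagawa_eq_one (W : WeierstrassCurve ℤ) {p : ℕ} [Fact p.Prime]
    (hp : ¬ (p : ℤ) ∣ W.Δ) : localTamagawa (W.map (Int.castRingHom ℚ)) p = 1 := by
  rw [localTamagawa, map_intCast_map_padic]
  have : ((W.map (Int.castRingHom ℤ_[p])).map (algebraMap ℤ_[p] ℚ_[p])).IsIntegral ℤ_[p] :=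
    ⟨_, rfl⟩
  refine componentIndex_eq_one ℤ_[p] _ (d := (W.map (Int.castRingHom ℤ_[p])).Δ) ?_ (map_Δ _ _).symm
  rw [map_Δ, PadicInt.isUnit_iff, eq_intCast]
  exact le_antisymm (PadicInt.norm_le_one _)
    (not_lt.mp fun h => hp ((PadicInt.norm_int_lt_one_iff_dvd _).mp h))

/-- The product over all primes is finite because the reduction is good away from the discriminant;
for an infinite support `finprod` would take the value `1`. -/
theorem dvd_globalTamagawa (W : WeierstrassCurve ℤ) (hΔ : W.Δ ≠ 0) {n p : ℕ} [hp : Fact p.Prime]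
    (h : n ∣ localTamagawa (W.map (Int.castRingHom ℚ)) p) :
    n ∣ globalTamagawa (W.map (Int.castRingHom ℚ)) := by
  obtain ⟨P, rfl⟩ : ∃ P : Nat.Primes, (P : ℕ) = p := ⟨⟨p, hp.out⟩, rfl⟩
  have hfin : {q : Nat.Primes | ((q : ℕ) : ℤ) ∣ W.Δ}.Finite := by
    refine Set.Finite.of_finite_image (f := fun q : Nat.Primes => (q : ℕ)) ?_
      (Nat.Primes.coe_nat_injective.injOn)
    refine (W.Δ.natAbs.divisors.finite_toSet).subset ?_
    rintro _ ⟨q, hq, rfl⟩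
    simpa [Int.natCast_dvd, hΔ] using hq
  set f : Nat.Primes → ℕ := fun q => haveI : Fact (q : ℕ).Prime := ⟨q.2⟩
    localTamagawa (W.map (Int.castRingHom ℚ)) q with hf
  have hone : ∀ q : Nat.Primes, ¬ ((q : ℕ) : ℤ) ∣ W.Δ → f q = 1 := fun q hq =>
    haveI : Fact (q : ℕ).Prime := ⟨q.2⟩
    localTamagawa_eq_one W hq
  have hp' : n ∣ f P := h
  change n ∣ ∏ᶠ q, f q
  clear_value f
  rw [finprod_eq_prod_of_mulSupport_subset (s := hfin.toFinset) f (fun q hq => by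
    by_contra hmem
    exact hq (hone q (by simpa using hmem)))]
  by_cases hmem : P ∈ hfin.toFinset
  · exact hp'.trans (Finset.dvd_prod_of_mem f hmem)
  · rw [hone _ (by simpa using hmem)] at hp'
    exact hp'.trans (one_dvd _)

end Global

/-! ### Integral models of the quotient curves -/

section Models
variable {R S : Type*} [CommRing R] [CommRing S]

/-- The equation of `quotientCurve ℓ a b` with parameters in any commutative ring. It is used over
`ℤ` and over `ℤ_[p]`. -/
def quotientModel (ℓ : ℕ) (a b : R) : WeierstrassCurve R :=
  if ℓ = 5 then
    { a₁ := a - b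
      a₂ := -(a * b)
      a₃ := -(a ^ 2 * b)
      a₄ := 5 * a * b * (a ^ 2 - 2 * a * b - b ^ 2)
      a₆ := a * b * (a ^ 4 - 15 * a ^ 3 * b + 5 * a ^ 2 * b ^ 2 - 10 * a * b ^ 3 - b ^ 4) }
  else
    { a₁ := a ^ 2 + a * b - b ^ 2
      a₂ := a ^ 2 * b ^ 2 - a * b ^ 3
      a₃ := a ^ 4 * b ^ 2 - a ^ 3 * b ^ 3
      a₄ := 5 * a * b * (a - b) * (a ^ 2 - b * a + b ^ 2) *
        (a ^ 3 - 5 * a ^ 2 * b + 2 * a * b ^ 2 + b ^ 3)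
      a₆ := a * b * (a - b) *
        (a ^ 9 - 18 * a ^ 8 * b + 76 * a ^ 7 * b ^ 2 - 182 * a ^ 6 * b ^ 3 +
          211 * a ^ 5 * b ^ 4 - 132 * a ^ 4 * b ^ 5 + 70 * a ^ 3 * b ^ 6 -
          37 * a ^ 2 * b ^ 7 + 9 * a * b ^ 8 + b ^ 9) }

theorem quotientCurve_eq (ℓ : ℕ) (a b : ℚ) : quotientCurve ℓ a b = quotientModel ℓ a b := rfl

theorem map_quotientModel (f : R →+* S) (ℓ : ℕ) (a b : R) :
    (quotientModel ℓ a b).map f = quotientModel ℓ (f a) (f b) := by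
  unfold quotientModel
  split_ifs <;> ext <;> simp only [WeierstrassCurve.map, map_mul, map_sub, map_add,
    map_neg, map_pow, map_ofNat]

theorem quotientCurve_natCast (ℓ a b : ℕ) :
    quotientCurve ℓ a b = (quotientModel ℓ (a : ℤ) b).map (Int.castRingHom ℚ) := by
  rw [map_quotientModel, quotientCurve_eq]
  simp

theorem quotientModel_five_Δ (a b : R) :
    (quotientModel 5 a b).Δ = -(a * b * (a ^ 2 + 11 * a * b - b ^ 2) ^ 5) := by
  simp only [quotientModel, if_pos, WeierstrassCurve.Δ, WeierstrassCurve.b₂, WeierstrassCurve.b₄,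
    WeierstrassCurve.b₆, WeierstrassCurve.b₈]
  ring

theorem quotientModel_seven_Δ (a b : R) :
    (quotientModel 7 a b).Δ =
      -(a * b * (a - b) * (a ^ 3 + 5 * a ^ 2 * b - 8 * a * b ^ 2 + b ^ 3) ^ 7) := by
  simp only [quotientModel, show ¬ (7 = 5) by norm_num, if_false, WeierstrassCurve.Δ,
    WeierstrassCurve.b₂, WeierstrassCurve.b₄, WeierstrassCurve.b₆, WeierstrassCurve.b₈]
  ring
end Models

/-! ### Tamagawa numbers of the quotient curves -/

section TateFormOfModel
variable {p : ℕ} [Fact p.Prime]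

theorem norm_add_mul_eq_one {u x : ℤ_[p]} (hu : ‖u‖ = 1) (hx : ‖x‖ < 1) (z : ℤ_[p]) :
    ‖u + x * z‖ = 1 := by
  have : ‖x * z‖ < 1 := by
    rw [norm_mul]; exact (mul_le_of_le_one_right (norm_nonneg _) z.norm_le_one).trans_lt hx
  rw [PadicInt.norm_add_eq_max_of_ne, hu, max_eq_left this.le]
  rw [hu]; exact this.ne'

/-- At a prime dividing exactly one of `a`, `b`, the given equation of the quotient curve is of
Tate's form: `a₂, a₃, a₄, a₆` are divisible by `ab`, while `a₁` and `a₆ / (ab)` are congruent, up to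
sign, to powers of the parameter that is a unit. -/
theorem isTateForm_map_quotientModel {ℓ : ℕ} (hℓ : ℓ = 5 ∨ ℓ = 7) {a b : ℤ_[p]} (hab : a * b ≠ 0)
    (h : ‖a‖ < 1 ∧ ‖b‖ = 1 ∨ ‖a‖ = 1 ∧ ‖b‖ < 1) :
    IsTateForm ((quotientModel ℓ a b).map (algebraMap ℤ_[p] ℚ_[p])) ‖a * b‖ := by
  have hdiv : ∀ {x : ℤ_[p]} (z : ℤ_[p]), x = a * b * z → ‖x‖ ≤ ‖a * b‖ := by
    rintro _ z rfl
    rw [norm_mul]; exact mul_le_of_le_one_right (norm_nonneg _) z.norm_le_one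
  have hunit : ∀ {x z : ℤ_[p]}, x = a * b * z → ‖z‖ = 1 → ‖x‖ = ‖a * b‖ := by
    rintro _ z rfl hz
    rw [norm_mul, hz, mul_one]
  have hlt : ‖a * b‖ < 1 := by
    rw [norm_mul]
    rcases h with ⟨ha, hb⟩ | ⟨ha, hb⟩
    · rwa [hb, mul_one]
    · rwa [ha, one_mul]
  -- a form whose reductions modulo `a` and modulo `b` are units (in the respective case) is a unit
  have key : ∀ {x u v z w : ℤ_[p]}, (‖b‖ = 1 → ‖u‖ = 1) → (‖a‖ = 1 → ‖v‖ = 1) → x = u + a * z →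
      x = v + b * w → ‖x‖ = 1 := by
    intro x u v z w hu hv hx hx'
    rcases h with ⟨ha, hb⟩ | ⟨ha, hb⟩
    · rw [hx]; exact norm_add_mul_eq_one (hu hb) ha z
    · rw [hx']; exact norm_add_mul_eq_one (hv ha) hb w
  have hnorm : ∀ {n : ℕ} {x : ℤ_[p]}, ‖x‖ = 1 → ‖x ^ n‖ = 1 := fun hx => by
    rw [norm_pow, hx, one_pow]
  have hnorm' : ∀ {n : ℕ} {x : ℤ_[p]}, ‖x‖ = 1 → ‖-x ^ n‖ = 1 := fun hx => by
    rw [norm_neg, norm_pow, hx, one_pow]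
  rcases hℓ with rfl | rfl
  · refine ⟨norm_pos_iff.mpr hab, hlt, ?_, ?_, ?_, ?_, ?_⟩ <;>
      simp only [quotientModel, if_pos, WeierstrassCurve.map, PadicInt.algebraMap_apply,
        PadicInt.padic_norm_e_of_padicInt]
    · exact key (u := -b ^ 1) (v := a ^ 1) (z := 1) (w := -1) hnorm' hnorm (by ring) (by ring)
    · exact hdiv (-1) (by ring)
    · exact hdiv (-a) (by ring)
    · exact hdiv (5 * (a ^ 2 - 2 * a * b - b ^ 2)) (by ring)
    · refine hunit rfl (key (u := -b ^ 4) (v := a ^ 4)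
        (z := a ^ 3 - 15 * a ^ 2 * b + 5 * a * b ^ 2 - 10 * b ^ 3)
        (w := -15 * a ^ 3 + 5 * a ^ 2 * b - 10 * a * b ^ 2 - b ^ 3) hnorm' hnorm ?_ ?_) <;> ring
  · refine ⟨norm_pos_iff.mpr hab, hlt, ?_, ?_, ?_, ?_, ?_⟩ <;>
      simp only [quotientModel, show ¬ (7 = 5) by norm_num, if_false, WeierstrassCurve.map,
        PadicInt.algebraMap_apply, PadicInt.padic_norm_e_of_padicInt]
    · exact key (u := -b ^ 2) (v := a ^ 2) (z := a + b) (w := a - b) hnorm' hnorm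
        (by ring) (by ring)
    · exact hdiv (a * b - b ^ 2) (by ring)
    · exact hdiv (a ^ 3 * b - a ^ 2 * b ^ 2) (by ring)
    · exact hdiv (5 * (a - b) * (a ^ 2 - b * a + b ^ 2) *
        (a ^ 3 - 5 * a ^ 2 * b + 2 * a * b ^ 2 + b ^ 3)) (by ring)
    · refine hunit (mul_assoc _ _ _) ?_
      rw [norm_mul]
      rw [key (x := a - b) (u := -b ^ 1) (v := a ^ 1) (z := 1) (w := -1) hnorm' hnorm (by ring)
        (by ring), one_mul]
      refine key (u := b ^ 9) (v := a ^ 9)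
        (z := a ^ 8 - 18 * a ^ 7 * b + 76 * a ^ 6 * b ^ 2 - 182 * a ^ 5 * b ^ 3 +
          211 * a ^ 4 * b ^ 4 - 132 * a ^ 3 * b ^ 5 + 70 * a ^ 2 * b ^ 6 -
          37 * a * b ^ 7 + 9 * b ^ 8)
        (w := -18 * a ^ 8 + 76 * a ^ 7 * b - 182 * a ^ 6 * b ^ 2 + 211 * a ^ 5 * b ^ 3
          - 132 * a ^ 4 * b ^ 4 + 70 * a ^ 3 * b ^ 5 - 37 * a ^ 2 * b ^ 6 + 9 * a * b ^ 7 + b ^ 8)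
        hnorm hnorm ?_ ?_ <;> ring

theorem dvd_globalTamagawa_quotientCurve {ℓ : ℕ} (hℓ : ℓ = 5 ∨ ℓ = 7) {a b : ℕ}
    (hΔ : (quotientModel ℓ (a : ℤ) b).Δ ≠ 0) (h : Admissible ℓ a b) :
    ℓ ∣ globalTamagawa (quotientCurve ℓ a b) := by
  obtain ⟨ha, hb, hcop, q, hq, hqab, k, hk⟩ := h
  rw [quotientCurve_natCast]
  have : Fact q.Prime := ⟨hq⟩
  refine dvd_globalTamagawa _ hΔ (p := q) ?_
  rw [localTamagawa, map_intCast_map_padic, map_quotientModel]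
  simp only [eq_intCast, Int.cast_natCast]
  have hab0 : a * b ≠ 0 := (Nat.mul_pos ha hb).ne'
  have hk0 : k ≠ 0 := by
    rintro rfl
    exact (hq.factorization_pos_of_dvd hab0 hqab).ne' hk
  -- `v_q(ab) = kℓ`, so that `‖ab‖ = ‖q ^ k‖ ^ ℓ`
  have hnorm : ‖(a : ℤ_[q]) * b‖ = ‖(q : ℚ_[q]) ^ k‖ ^ ℓ := by
    have hm : ‖((a * b / q ^ (a * b).factorization q : ℕ) : ℤ_[q])‖ = 1 :=
      PadicInt.norm_natCast_eq_one_iff.mpr (Nat.coprime_ordCompl hq hab0)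
    rw [← Nat.cast_mul, ← Nat.ordProj_mul_ordCompl_eq_self (a * b) q, Nat.cast_mul, norm_mul, hm,
      hk, mul_one, Nat.cast_pow, norm_pow, PadicInt.norm_p, norm_pow, Padic.norm_p, ← pow_mul,
      mul_comm k]
  have hT := isTateForm_map_quotientModel (p := q) hℓ (a := a) (b := b)
    (by exact_mod_cast hab0) (by
      rw [PadicInt.norm_natCast_eq_one_iff, PadicInt.norm_natCast_eq_one_iff,
        PadicInt.norm_natCast_lt_one_iff, PadicInt.norm_natCast_lt_one_iff]
      rcases (hq.dvd_mul).mp hqab with h | h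
      · exact .inl ⟨h, (hcop.coprime_dvd_left h)⟩
      · exact .inr ⟨(hcop.symm.coprime_dvd_left h), h⟩)
  rw [hnorm] at hT
  have hq0 : (q : ℚ_[q]) ≠ 0 := by exact_mod_cast hq.ne_zero
  refine hT.dvd_componentIndex hℓ (pow_ne_zero k hq0) ?_
  rw [norm_pow]
  exact pow_lt_one₀ (norm_nonneg _) Padic.norm_p_lt_one hk0

end TateFormOfModel

/-! ### Homogenization of polynomials in `x` -/

section Homogenization
open MvPolynomial

/-- The form `Zⁿ p(X / Z)` of degree `n` in the projective coordinates `X 0`, `X 1`, `X 2`. -/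
noncomputable def homogenization (p : Polynomial ℚ) (n : ℕ) : MvPolynomial (Fin 3) ℚ :=
  ∑ i ∈ Finset.range (n + 1), C (p.coeff i) * X 0 ^ i * X 2 ^ (n - i)

/-- The quadratic form `Q` for which the homogeneous equation of the curve reads `X³ = Z Q`. -/
noncomputable def cofactorZ (W : WeierstrassCurve ℚ) : MvPolynomial (Fin 3) ℚ :=
  X 1 * X 1 + C W.a₁ * (X 0 * X 1) + C W.a₃ * (X 1 * X 2) - C W.a₂ * (X 0 * X 0)
    - C W.a₄ * (X 0 * X 2) - C W.a₆ * (X 2 * X 2)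

/-- The form `Zⁿ⁻ᵉ p(X / Z)`, made regular at the point at infinity: there `X / Z` has a pole, and
the equation `X³ = Z Q` is used to write `X ^ i = X ^ (i % 3) Q ^ (i / 3) Z ^ (i / 3)`. No
subtraction in the exponent of `Z` truncates when `i ≤ n` and `3e ≤ n ≤ 3e + 1`. -/
noncomputable def homogenizationAtInfinity (W : WeierstrassCurve ℚ) (p : Polynomial ℚ) (n e : ℕ) :
    MvPolynomial (Fin 3) ℚ :=
  ∑ i ∈ Finset.range (n + 1),
    C (p.coeff i) * X 0 ^ (i % 3) * cofactorZ W ^ (i / 3) * X 2 ^ (n - i + i / 3 - e)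

theorem isHomogeneous_homogenization (p : Polynomial ℚ) (n : ℕ) :
    (homogenization p n).IsHomogeneous n := by
  refine IsHomogeneous.sum _ _ _ fun i hi => ?_
  have h := ((isHomogeneous_C (Fin 3) (p.coeff i)).mul (isHomogeneous_X_pow (R := ℚ) 0 i)).mul
    (isHomogeneous_X_pow (R := ℚ) (2 : Fin 3) (n - i))
  rwa [show 0 + i + (n - i) = n by have := Finset.mem_range.mp hi; omega] at h

theorem isHomogeneous_cofactorZ (W : WeierstrassCurve ℚ) : (cofactorZ W).IsHomogeneous 2 := by
  have hXX : ∀ i j : Fin 3, (X i * X j : MvPolynomial (Fin 3) ℚ).IsHomogeneous 2 := fun i j =>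
    (isHomogeneous_X ℚ i).mul (isHomogeneous_X ℚ j)
  have hC : ∀ (c : ℚ) (i j : Fin 3), (C c * (X i * X j)).IsHomogeneous 2 := fun c i j => by
    simpa using (isHomogeneous_C (Fin 3) c).mul (hXX i j)
  exact ((((hXX 1 1).add (hC _ 0 1)).add (hC _ 1 2)).sub (hC _ 0 0)).sub (hC _ 0 2) |>.sub
    (hC _ 2 2)

theorem isHomogeneous_homogenizationAtInfinity (W : WeierstrassCurve ℚ) (p : Polynomial ℚ)
    {n m e : ℕ} (hn : 3 * e ≤ n) (hn' : n ≤ 3 * e + 1) (hm : m = n - e) :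
    (homogenizationAtInfinity W p n e).IsHomogeneous m := by
  refine IsHomogeneous.sum _ _ _ fun i hi => ?_
  have h := (((isHomogeneous_C (Fin 3) (p.coeff i)).mul
    (isHomogeneous_X_pow (R := ℚ) 0 (i % 3))).mul ((isHomogeneous_cofactorZ W).pow (i / 3))).mul
      (isHomogeneous_X_pow (R := ℚ) (2 : Fin 3) (n - i + i / 3 - e))
  rwa [show 0 + i % 3 + 2 * (i / 3) + (n - i + i / 3 - e) = m by
    have := Finset.mem_range.mp hi; omega] at h

variable {A : Type*} [Field A] [Algebra ℚ A]

theorem aeval_homogenization_affine {p : Polynomial ℚ} {n : ℕ} (hp : p.natDegree ≤ n) (x y : A) :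
    aeval ![x, y, 1] (homogenization p n) = Polynomial.aeval x p := by
  rw [Polynomial.aeval_eq_sum_range' (Nat.lt_succ_of_le hp)]
  simp [homogenization, Algebra.smul_def]

theorem aeval_cofactorZ (W : WeierstrassCurve ℚ) {x y : A}
    (h : (W.map (algebraMap ℚ A)).toAffine.Equation x y) :
    aeval ![x, y, 1] (cofactorZ W) = x ^ 3 := by
  rw [Affine.equation_iff] at h
  simp only [cofactorZ, map_sub, map_add, map_mul, aeval_X, aeval_C]
  simp only [WeierstrassCurve.map] at h
  simp [-eq_ratCast]
  linear_combination h

theorem aeval_homogenizationAtInfinity_affine {W : WeierstrassCurve ℚ} {p : Polynomial ℚ}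
    {n e : ℕ} (hp : p.natDegree ≤ n) {x y : A}
    (h : (W.map (algebraMap ℚ A)).toAffine.Equation x y) :
    aeval ![x, y, 1] (homogenizationAtInfinity W p n e) = Polynomial.aeval x p := by
  rw [Polynomial.aeval_eq_sum_range' (Nat.lt_succ_of_le hp), homogenizationAtInfinity, map_sum]
  refine Finset.sum_congr rfl fun i _ => ?_
  rw [map_mul, map_mul, map_mul, map_pow, map_pow, aeval_cofactorZ W h]
  simp only [aeval_C, aeval_X, map_pow]
  simp only [Matrix.cons_val_zero, Matrix.cons_val, one_pow, mul_one]
  rw [Algebra.smul_def, mul_assoc, ← pow_mul, ← pow_add, Nat.mod_add_div]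

theorem aeval_homogenization_infinity (p : Polynomial ℚ) {n : ℕ} (hn : n ≠ 0) :
    aeval (![0, 1, 0] : Fin 3 → A) (homogenization p n) = 0 := by
  rw [homogenization, map_sum]
  refine Finset.sum_eq_zero fun i _ => ?_
  rcases eq_or_ne i 0 with rfl | hi
  · simp [hn]
  · simp [hi]

theorem aeval_homogenizationAtInfinity_infinity (W : WeierstrassCurve ℚ) (p : Polynomial ℚ)
    {n e : ℕ} (hn : 3 * e ≤ n) (hn' : n ≤ 3 * e + 1) :
    aeval (![0, 1, 0] : Fin 3 → A) (homogenizationAtInfinity W p n e) =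
      if n = 3 * e then algebraMap ℚ A (p.coeff n) else 0 := by
  have hQ : aeval (![0, 1, 0] : Fin 3 → A) (cofactorZ W) = 1 := by simp [cofactorZ]
  rw [homogenizationAtInfinity, map_sum]
  have hterm : ∀ i ∈ Finset.range (n + 1), aeval (![0, 1, 0] : Fin 3 → A)
      (C (p.coeff i) * X 0 ^ (i % 3) * cofactorZ W ^ (i / 3) * X 2 ^ (n - i + i / 3 - e)) =
      if i = 3 * e ∧ n = 3 * e then algebraMap ℚ A (p.coeff i) else 0 := fun i hi => by
    have hi' := Finset.mem_range.mp hi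
    rw [map_mul, map_mul, map_mul, map_pow _ (cofactorZ W), hQ]
    simp only [aeval_C, aeval_X, map_pow, one_pow, mul_one]
    simp only [Matrix.cons_val_zero, Matrix.cons_val]
    split_ifs with h
    · rw [show i % 3 = 0 by omega, show n - i + i / 3 - e = 0 by omega]; simp
    · by_cases h3 : i % 3 = 0
      · rw [zero_pow (show n - i + i / 3 - e ≠ 0 by omega), mul_zero]
      · rw [zero_pow h3, mul_zero, zero_mul]
  rw [Finset.sum_congr rfl hterm]
  by_cases hne : n = 3 * e
  · simp [hne]
  · simp [hne]

end Homogenization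

/-! ### Isogenies given by rational functions of `x` -/

section Criterion

/-- Homogeneous coordinates of the image `(A / D², Y)` of a point under a normalized isogeny. The
arguments `G`, `M`, `D` stand for homogenizations of `A D`, `M` and `D³`. -/
noncomputable def isogenyTriple (W : WeierstrassCurve ℚ) (G M D : MvPolynomial (Fin 3) ℚ) :
    Fin 3 → MvPolynomial (Fin 3) ℚ :=
  open MvPolynomial in
  ![G, C (1 / 2) * ((C 2 * X 1 + C W.a₁ * X 0 + C W.a₃ * X 2) * M - C W.a₁ * G - C W.a₃ * D), D]

theorem isHomogeneous_isogenyTriple (W : WeierstrassCurve ℚ) {G M D : MvPolynomial (Fin 3) ℚ}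
    {n : ℕ} (hG : G.IsHomogeneous (n + 1)) (hM : M.IsHomogeneous n) (hD : D.IsHomogeneous (n + 1))
    (i : Fin 3) : (isogenyTriple W G M D i).IsHomogeneous (n + 1) := by
  open MvPolynomial in
  have hC : ∀ (c : ℚ) {p : MvPolynomial (Fin 3) ℚ} {k : ℕ}, p.IsHomogeneous k →
      (C c * p).IsHomogeneous k := fun c p k hp => by
    simpa using (isHomogeneous_C (Fin 3) c).mul hp
  fin_cases i
  · exact hG
  · refine hC _ (((add_comm 1 n ▸ (IsHomogeneous.mul (m := 1) ?_ hM)).sub (hC _ hG)).sub (hC _ hD))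
    exact ((hC _ (isHomogeneous_X ℚ _)).add (hC _ (isHomogeneous_X ℚ _))).add
      (hC _ (isHomogeneous_X ℚ _))
  · exact hD

/-- The data of an isogeny `W → W'` of degree `2m + 1` given by `X = A / D²` and
`2Y + a₁X + a₃ = (2y + a₁x + a₃) M / D³`, where `D` vanishes at the `x`-coordinates of the nonzero
points of the kernel. The field `identity` says that `(X, Y)` lies on `W'`. -/
structure IsNormalizedIsogeny (W W' : WeierstrassCurve ℚ) (A D M : Polynomial ℚ) (m : ℕ) :
    Prop where
  a₁ : W'.a₁ = W.a₁
  a₃ : W'.a₃ = W.a₃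
  Δ_ne_zero : W'.Δ ≠ 0
  natDegree_A : A.natDegree ≤ 2 * m + 1
  natDegree_D : D.natDegree ≤ m
  natDegree_M : M.natDegree ≤ 3 * m
  coeff_M : M.coeff (3 * m) ≠ 0
  isCoprime : IsCoprime A D
  identity : open Polynomial in
    (4 * X ^ 3 + C W.b₂ * X ^ 2 + 2 * C W.b₄ * X + C W.b₆) * M ^ 2 =
      4 * A ^ 3 + C W'.b₂ * A ^ 2 * D ^ 2 + 2 * C W'.b₄ * A * D ^ 4 + C W'.b₆ * D ^ 6

variable {W W' : WeierstrassCurve ℚ} {A D M : Polynomial ℚ} {m : ℕ}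

/-- The `y`-coordinate of the image of an affine point `(x, y)` outside the kernel. -/
noncomputable def isogenyY (W : WeierstrassCurve ℚ) (A D M : Polynomial ℚ) (x y : QBar) : QBar :=
  open Polynomial in
  ((2 * y + algebraMap ℚ QBar W.a₁ * x + algebraMap ℚ QBar W.a₃) * (aeval x M / aeval x D ^ 3) -
    algebraMap ℚ QBar W.a₁ * (aeval x A / aeval x D ^ 2) - algebraMap ℚ QBar W.a₃) / 2

open Polynomial in
theorem IsNormalizedIsogeny.aeval_identity (h : IsNormalizedIsogeny W W' A D M m) (x : QBar) :
    (4 * x ^ 3 + algebraMap ℚ QBar W.b₂ * x ^ 2 + 2 * algebraMap ℚ QBar W.b₄ * x +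
      algebraMap ℚ QBar W.b₆) * aeval x M ^ 2 =
    4 * aeval x A ^ 3 + algebraMap ℚ QBar W'.b₂ * aeval x A ^ 2 * aeval x D ^ 2 +
      2 * algebraMap ℚ QBar W'.b₄ * aeval x A * aeval x D ^ 4 +
      algebraMap ℚ QBar W'.b₆ * aeval x D ^ 6 := by
  have := congrArg (aeval x) h.identity
  simpa only [map_mul, map_add, map_pow, map_ofNat, aeval_X, aeval_C] using this

theorem sq_of_equation {x y : QBar} (hxy : (W.map (algebraMap ℚ QBar)).toAffine.Equation x y) :
    (2 * y + algebraMap ℚ QBar W.a₁ * x + algebraMap ℚ QBar W.a₃) ^ 2 =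
      4 * x ^ 3 + algebraMap ℚ QBar W.b₂ * x ^ 2 + 2 * algebraMap ℚ QBar W.b₄ * x +
      algebraMap ℚ QBar W.b₆ := by
  rw [Affine.equation_iff] at hxy
  simp only [WeierstrassCurve.map] at hxy
  simp only [WeierstrassCurve.b₂, WeierstrassCurve.b₄, WeierstrassCurve.b₆, map_add, map_mul,
    map_pow, map_ofNat]
  linear_combination 4 * hxy

theorem equation_of_sq {x y : QBar}
    (h : (2 * y + algebraMap ℚ QBar W.a₁ * x + algebraMap ℚ QBar W.a₃) ^ 2 =
      4 * x ^ 3 + algebraMap ℚ QBar W.b₂ * x ^ 2 + 2 * algebraMap ℚ QBar W.b₄ * x +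
      algebraMap ℚ QBar W.b₆) : (W.map (algebraMap ℚ QBar)).toAffine.Equation x y := by
  rw [Affine.equation_iff]
  simp only [WeierstrassCurve.b₂, WeierstrassCurve.b₄, WeierstrassCurve.b₆, map_add, map_mul,
    map_pow, map_ofNat] at h
  simp only [WeierstrassCurve.map]
  linear_combination h / 4

open Polynomial in
theorem IsNormalizedIsogeny.nonsingular (h : IsNormalizedIsogeny W W' A D M m) {x y : QBar}
    (hxy : (W.map (algebraMap ℚ QBar)).toAffine.Equation x y) (hD : aeval x D ≠ 0) :
    (W'.map (algebraMap ℚ QBar)).toAffine.Nonsingular (aeval x A / aeval x D ^ 2)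
      (isogenyY W A D M x y) := by
  have hΔ : (W'.map (algebraMap ℚ QBar)).Δ ≠ 0 := by
    rw [map_Δ]
    exact (_root_.map_ne_zero _).mpr h.Δ_ne_zero
  refine (Affine.equation_iff_nonsingular_of_Δ_ne_zero hΔ).mp (equation_of_sq ?_)
  rw [h.a₁, h.a₃, show 2 * isogenyY W A D M x y + algebraMap ℚ QBar W.a₁ *
    (aeval x A / aeval x D ^ 2) + algebraMap ℚ QBar W.a₃ =
    (2 * y + algebraMap ℚ QBar W.a₁ * x + algebraMap ℚ QBar W.a₃) * (aeval x M / aeval x D ^ 3) by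
      rw [isogenyY]; ring, mul_pow, sq_of_equation hxy]
  have := h.aeval_identity x
  field_simp
  linear_combination this

open Classical Polynomial in
/-- The map on geometric points that the data of a normalized isogeny define. -/
noncomputable def IsNormalizedIsogeny.toFun (h : IsNormalizedIsogeny W W' A D M m) :
    GeomPoint W → GeomPoint W'
  | .zero => .zero
  | .some x _ hxy => if hD : aeval x D = 0 then .zero else .some _ _ (h.nonsingular hxy.1 hD)

theorem evalTriple_isogenyTriple_some (G N E : MvPolynomial (Fin 3) ℚ) {x y : QBar}
    (hxy : (W.map (algebraMap ℚ QBar)).toAffine.Nonsingular x y) :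
    evalTriple (isogenyTriple W G N E) (.some x y hxy : GeomPoint W) =
      ![MvPolynomial.aeval ![x, y, 1] G,
        ((2 * y + algebraMap ℚ QBar W.a₁ * x + algebraMap ℚ QBar W.a₃) *
          MvPolynomial.aeval ![x, y, 1] N - algebraMap ℚ QBar W.a₁ * MvPolynomial.aeval ![x, y, 1] G
          - algebraMap ℚ QBar W.a₃ * MvPolynomial.aeval ![x, y, 1] E) / 2,
        MvPolynomial.aeval ![x, y, 1] E] := by
  ext i
  fin_cases i
  · rfl
  · simp [evalTriple, isogenyTriple, homCoords]
    ring
  · rfl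

theorem evalTriple_isogenyTriple_zero (G N E : MvPolynomial (Fin 3) ℚ) :
    evalTriple (isogenyTriple W G N E) (.zero : GeomPoint W) =
      ![MvPolynomial.aeval ![0, 1, 0] G,
        MvPolynomial.aeval ![0, 1, 0] N - (algebraMap ℚ QBar W.a₁ * MvPolynomial.aeval ![0, 1, 0] G
          + algebraMap ℚ QBar W.a₃ * MvPolynomial.aeval ![0, 1, 0] E) / 2,
        MvPolynomial.aeval ![0, 1, 0] E] := by
  ext i
  fin_cases i
  · rfl
  · simp [evalTriple, isogenyTriple, homCoords]
    ring
  · rfl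

open Polynomial in
/-- The homogeneous coordinates describe the map at every affine point. At a point of the kernel
they become `[0 : c : 0]` with `c ≠ 0`, because `A` and `D` have no common root. -/
theorem IsNormalizedIsogeny.exists_smul_homCoords (h : IsNormalizedIsogeny W W' A D M m)
    {x y : QBar} (hxy : (W.map (algebraMap ℚ QBar)).toAffine.Nonsingular x y)
    {G N E : MvPolynomial (Fin 3) ℚ} (hG : MvPolynomial.aeval ![x, y, 1] G = aeval x (A * D))
    (hN : MvPolynomial.aeval ![x, y, 1] N = aeval x M)
    (hE : MvPolynomial.aeval ![x, y, 1] E = aeval x (D ^ 3)) :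
    ∃ c : QBar, c ≠ 0 ∧ evalTriple (isogenyTriple W G N E) (.some x y hxy : GeomPoint W) =
      c • homCoords (h.toFun (.some x y hxy)) := by
  rw [evalTriple_isogenyTriple_some, hG, hN, hE, map_mul, map_pow, IsNormalizedIsogeny.toFun]
  split_ifs with hD
  · refine ⟨(2 * y + algebraMap ℚ QBar W.a₁ * x + algebraMap ℚ QBar W.a₃) * aeval x M / 2, ?_, ?_⟩
    · have hA : aeval x A ≠ 0 := by
        obtain ⟨u, v, huv⟩ := h.isCoprime
        intro hA
        simpa [hA, hD] using congrArg (aeval x) huv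
      have := h.aeval_identity x
      rw [← sq_of_equation hxy.1, ← mul_pow, hD] at this
      intro h0
      rw [div_eq_zero_iff, or_iff_left two_ne_zero] at h0
      rw [h0] at this
      simp [hA] at this
    · ext i
      fin_cases i <;> simp [hD, homCoords]
  · refine ⟨aeval x D ^ 3, pow_ne_zero 3 hD, ?_⟩
    ext i
    fin_cases i
    · simp [homCoords]
      field_simp
    · simp [homCoords, isogenyY]
      field_simp
    · simp [homCoords]

/-- The plain homogenizations describe the map near the affine points, and the homogenizations that
are regular at infinity describe it near `O`. Of these, the ones of `A D` and `D³` vanish at `O`,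
and the one of `M` does not, since `M` has degree exactly `3m`. -/
theorem IsNormalizedIsogeny.isMorphism (h : IsNormalizedIsogeny W W' A D M m) (hm : m ≠ 0) :
    IsMorphism h.toFun := by
  have hAD : (A * D).natDegree ≤ 3 * m + 1 :=
    Polynomial.natDegree_mul_le.trans (by have := h.natDegree_A; have := h.natDegree_D; omega)
  have hD3 : (D ^ 3).natDegree ≤ 3 * m + 1 :=
    Polynomial.natDegree_pow_le.trans (by have := h.natDegree_D; omega)
  intro R
  cases R with
  | zero =>
    set F := isogenyTriple W (homogenizationAtInfinity W (A * D) (3 * m + 1) m)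
      (homogenizationAtInfinity W M (3 * m) m)
      (homogenizationAtInfinity W (D ^ 3) (3 * m + 1) m) with hF
    have hval : evalTriple F (.zero : GeomPoint W) =
        algebraMap ℚ QBar (M.coeff (3 * m)) • ![0, 1, 0] := by
      rw [hF, evalTriple_isogenyTriple_zero,
        aeval_homogenizationAtInfinity_infinity _ _ (by omega) (by omega),
        aeval_homogenizationAtInfinity_infinity _ _ (by omega) (by omega),
        aeval_homogenizationAtInfinity_infinity _ _ (by omega) (by omega)]
      simp
    have hc : algebraMap ℚ QBar (M.coeff (3 * m)) ≠ 0 := (map_ne_zero _).mpr h.coeff_M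
    refine ⟨2 * m + 1, F, fun i => isHomogeneous_isogenyTriple W
      (isHomogeneous_homogenizationAtInfinity W _ (by omega) (by omega) (by omega))
      (isHomogeneous_homogenizationAtInfinity W _ (by omega) (by omega) (by omega))
      (isHomogeneous_homogenizationAtInfinity W _ (by omega) (by omega) (by omega)) i, ?_, ?_⟩
    · rw [hval]
      intro h0
      exact hc (by simpa using congrFun h0 1)
    · rintro (_ | ⟨x, y, hxy⟩) -
      · exact ⟨_, hc, hval⟩
      · exact h.exists_smul_homCoords hxy
          (aeval_homogenizationAtInfinity_affine hAD hxy.1)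
          (aeval_homogenizationAtInfinity_affine h.natDegree_M hxy.1)
          (aeval_homogenizationAtInfinity_affine hD3 hxy.1)
  | some x y hxy =>
    have hsome : ∀ {x y : QBar} (hxy : (W.map (algebraMap ℚ QBar)).toAffine.Nonsingular x y), _ :=
      fun {x y} hxy => h.exists_smul_homCoords hxy (aeval_homogenization_affine hAD x y)
        (aeval_homogenization_affine h.natDegree_M x y) (aeval_homogenization_affine hD3 x y)
    refine ⟨3 * m + 1, _, isHomogeneous_isogenyTriple W (isHomogeneous_homogenization (A * D) _)
      (isHomogeneous_homogenization M _) (isHomogeneous_homogenization (D ^ 3) _), ?_, ?_⟩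
    · obtain ⟨c, hc, he⟩ := hsome hxy
      rw [he]
      refine smul_ne_zero hc fun h0 => ?_
      cases hφ : h.toFun (.some x y hxy) with
      | zero => rw [hφ] at h0; simpa [homCoords] using congrFun h0 1
      | some => rw [hφ] at h0; simpa [homCoords] using congrFun h0 2
    · rintro (_ | ⟨x', y', hxy'⟩) hS
      · refine absurd ?_ hS
        rw [evalTriple_isogenyTriple_zero, aeval_homogenization_infinity _ (by omega),
          aeval_homogenization_infinity _ (by omega), aeval_homogenization_infinity _ (by omega)]
        ext i
        fin_cases i <;> simp
      · exact hsome hxy'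

/-- A normalized isogeny is a quotient by `⟨P⟩` if the roots of `D` are exactly the `x`-coordinates
of the nonzero multiples of `P`. -/
theorem IsNormalizedIsogeny.isQuotientBy (h : IsNormalizedIsogeny W W' A D M m) (hm : m ≠ 0)
    {P : W.toAffine.Point} (hP : ∀ n : ℤ, ∀ x y hxy, n • P = .some x y hxy → D.eval x = 0)
    (hD : ∀ x : QBar, Polynomial.aeval x D = 0 → ∃ (n : ℤ) (x₀ y₀ : ℚ) (h₀ : _),
      n • P = .some x₀ y₀ h₀ ∧ algebraMap ℚ QBar x₀ = x) : IsQuotientBy W P W' := by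
  refine ⟨h.toFun, h.isMorphism hm, rfl, ?_⟩
  rintro (_ | ⟨x, y, hxy⟩)
  · exact ⟨fun _ => ⟨0, by rw [zero_zsmul]; rfl⟩, fun _ => rfl⟩
  · rw [IsNormalizedIsogeny.toFun]
    constructor
    · split_ifs with hx
      · rintro -
        obtain ⟨n, x₀, y₀, h₀, hn, rfl⟩ := hD x hx
        have h₀' := ((W.toAffine.map_nonsingular (algebraMap ℚ QBar).injective x₀ y₀).mpr h₀)
        rcases Affine.Point.X_eq_iff (h₁ := hxy) (h₂ := h₀') |>.mp rfl with he | he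
        · exact ⟨n, by rw [hn, he]; rfl⟩
        · refine ⟨-n, ?_⟩
          rw [neg_zsmul, hn, he, Affine.Point.neg_some, Affine.Point.neg_some]
          simp only [toGeom, Affine.Point.some.injEq, true_and]
          rw [Affine.negY, Affine.negY]
          simp [WeierstrassCurve.map]
      · intro h0; cases h0
    · rintro ⟨n, hn⟩
      cases hnP : n • P with
      | zero => rw [hnP] at hn; cases hn
      | some x₀ y₀ h₀ =>
        rw [hnP] at hn
        simp only [toGeom, Affine.Point.some.injEq] at hn
        have := hP n x₀ y₀ h₀ hnP
        rw [dif_pos]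
        rw [hn.1, Polynomial.aeval_algebraMap_apply, Polynomial.coe_aeval_eq_eval, this, map_zero]

end Criterion

/-! ### Multiples of an explicit point -/

section Addition
variable {F : Type*} [Field F] [DecidableEq F] {W : WeierstrassCurve F}

/-- Addition with a given slope `l` of the chord. -/
theorem some_add_some_eq {x₁ y₁ x₂ y₂ x₃ y₃ : F} {h₁ : W.toAffine.Nonsingular x₁ y₁}
    {h₂ : W.toAffine.Nonsingular x₂ y₂} (h₃ : W.toAffine.Nonsingular x₃ y₃) (l : F)
    (hx : x₁ ≠ x₂) (hl : y₁ - y₂ = l * (x₁ - x₂)) (hx₃ : x₃ = l ^ 2 + W.a₁ * l - W.a₂ - x₁ - x₂)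
    (hy₃ : y₃ = -(l * (x₃ - x₁) + y₁) - W.a₁ * x₃ - W.a₃) :
    Affine.Point.some x₁ y₁ h₁ + .some x₂ y₂ h₂ = .some x₃ y₃ h₃ := by
  have hs : W.toAffine.slope x₁ x₂ y₁ y₂ = l := by
    rw [Affine.slope_of_X_ne hx, hl, mul_div_cancel_right₀ _ (sub_ne_zero.mpr hx)]
  rw [Affine.Point.add_of_X_ne hx, Affine.Point.some.injEq, hs]
  have hX : W.toAffine.addX x₁ x₂ l = x₃ := hx₃.symm
  refine ⟨hX, ?_⟩
  rw [Affine.addY, Affine.negAddY, hX, Affine.negY, hy₃]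

/-- Duplication with a given slope `l` of the tangent. -/
theorem two_nsmul_some_eq {x₁ y₁ x₃ y₃ : F} {h₁ : W.toAffine.Nonsingular x₁ y₁}
    (h₃ : W.toAffine.Nonsingular x₃ y₃) (l : F) (hy : 2 * y₁ + W.a₁ * x₁ + W.a₃ ≠ 0)
    (hl : 3 * x₁ ^ 2 + 2 * W.a₂ * x₁ + W.a₄ - W.a₁ * y₁ = l * (2 * y₁ + W.a₁ * x₁ + W.a₃))
    (hx₃ : x₃ = l ^ 2 + W.a₁ * l - W.a₂ - x₁ - x₁)
    (hy₃ : y₃ = -(l * (x₃ - x₁) + y₁) - W.a₁ * x₃ - W.a₃) :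
    2 • Affine.Point.some x₁ y₁ h₁ = .some x₃ y₃ h₃ := by
  have hneg : y₁ - W.toAffine.negY x₁ y₁ = 2 * y₁ + W.a₁ * x₁ + W.a₃ := by
    rw [Affine.negY]; ring
  have hne : y₁ ≠ W.toAffine.negY x₁ y₁ := sub_ne_zero.mp (hneg ▸ hy)
  have hs : W.toAffine.slope x₁ x₁ y₁ y₁ = l := by
    rw [Affine.slope_of_Y_ne rfl hne, hneg, hl, mul_div_cancel_right₀ _ hy]
  rw [two_nsmul, Affine.Point.add_self_of_Y_ne hne, Affine.Point.some.injEq, hs]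
  have hX : W.toAffine.addX x₁ x₁ l = x₃ := hx₃.symm
  refine ⟨hX, ?_⟩
  rw [Affine.addY, Affine.negAddY, hX, Affine.negY, hy₃]

end Addition

/-! ### Coprimality and leading coefficients -/

section Coprime
open Polynomial

theorem isCoprime_X_sub_C_of_eval_ne_zero {A : ℚ[X]} {c : ℚ} (h : A.eval c ≠ 0) :
    IsCoprime A (X - C c) :=
  ((irreducible_X_sub_C c).coprime_iff_not_dvd.mpr fun hd => h (dvd_iff_isRoot.mp hd)).symm

theorem isCoprime_X_of_eval_ne_zero {A : ℚ[X]} (h : A.eval 0 ≠ 0) : IsCoprime A X := by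
  simpa using isCoprime_X_sub_C_of_eval_ne_zero h

theorem natDegree_and_coeff_of_monic {D S : ℚ[X]} {m : ℕ} (hD : D.Monic) (hm : D.natDegree = m)
    (hS : S.natDegree < 3 * m) :
    (D ^ 3 - S).natDegree ≤ 3 * m ∧ (D ^ 3 - S).coeff (3 * m) ≠ 0 := by
  have hd : (D ^ 3).natDegree = 3 * m := by rw [hD.natDegree_pow, hm]
  constructor
  · exact (natDegree_sub_le _ _).trans (max_le hd.le hS.le)
  · rw [coeff_sub, coeff_eq_zero_of_natDegree_lt hS, ← hd, (hD.pow 3).coeff_natDegree]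
    norm_num

end Coprime

/-! ### Multiples of a point of odd order -/

section Multiples

theorem exists_zsmul_eq_or_eq_neg {G : Type*} [AddCommGroup G] {P : G} {m : ℕ}
    (h : (2 * m + 1) • P = 0) (n : ℤ) :
    ∃ k : ℕ, k ≤ m ∧ (n • P = k • P ∨ n • P = -(k • P)) := by
  have hz : ((2 * m + 1 : ℕ) : ℤ) • P = 0 := by rw [natCast_zsmul]; exact h
  obtain ⟨r, hr⟩ := Int.eq_ofNat_of_zero_le (Int.emod_nonneg n (b := (2 * m + 1 : ℕ)) (by omega))
  have hlt := Int.emod_lt_of_pos n (b := ((2 * m + 1 : ℕ) : ℤ)) (by omega)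
  have hn : n • P = r • P := by
    rw [← natCast_zsmul, ← hr, Int.emod_def, sub_zsmul, mul_comm, mul_zsmul, hz, zsmul_zero,
      neg_zero, add_zero]
  rcases le_or_gt r m with hle | hgt
  · exact ⟨r, hle, .inl hn⟩
  · refine ⟨2 * m + 1 - r, by omega, .inr ?_⟩
    rw [hn, eq_neg_iff_add_eq_zero, ← add_nsmul, show r + (2 * m + 1 - r) = 2 * m + 1 by omega, h]

theorem eval_eq_zero_of_zsmul {W : WeierstrassCurve ℚ} {P : W.toAffine.Point} {D : Polynomial ℚ}
    {m : ℕ} (h : (2 * m + 1) • P = 0)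
    (hk : ∀ k : ℕ, k ≠ 0 → k ≤ m → ∃ x y hxy, k • P = .some x y hxy ∧ D.eval x = 0)
    (n : ℤ) (x y : ℚ) (hxy : W.toAffine.Nonsingular x y) (hn : n • P = .some x y hxy) :
    D.eval x = 0 := by
  obtain ⟨k, hkm, hk'⟩ := exists_zsmul_eq_or_eq_neg h n
  have hk0 : k ≠ 0 := by
    rintro rfl
    rw [zero_nsmul, neg_zero, or_self, hn] at hk'
    exact Affine.Point.some_ne_zero hxy hk'
  obtain ⟨x₀, y₀, h₀, he, hx₀⟩ := hk k hk0 hkm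
  rw [he, hn] at hk'
  rwa [Affine.Point.X_eq_iff.mpr hk']

end Multiples

/-! ### The family with a point of order `5` -/

section Five
variable {a b : ℚ}

theorem torsionCurve_five (a b : ℚ) : torsionCurve 5 a b =
    ⟨a - b, -(a * b), -(a ^ 2 * b), 0, 0⟩ := rfl

theorem torsionCurve_five_Δ (a b : ℚ) :
    (torsionCurve 5 a b).Δ = -(a ^ 5 * b ^ 5 * (a ^ 2 + 11 * a * b - b ^ 2)) := by
  simp only [torsionCurve_five, WeierstrassCurve.Δ, WeierstrassCurve.b₂, WeierstrassCurve.b₄,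
    WeierstrassCurve.b₆, WeierstrassCurve.b₈]
  ring

open Polynomial in
/-- Vélu's formulas for the subgroup `{O, ±(0, 0), ±2(0, 0)}`, whose nonzero points have
`x`-coordinates `0` and `ab`: with `t = 6x_Q² + b₂x_Q + b₄` and `u = 4x_Q³ + b₂x_Q² + 2b₄x_Q + b₆`,
`X = x + ∑ (t / (x - x_Q) + u / (x - x_Q)²)`, the sum over the two values of `x_Q`, and `M / D³` is
the derivative of `X`. -/
theorem isNormalizedIsogeny_five (ha : a ≠ 0) (hb : b ≠ 0) (hΔ : (quotientCurve 5 a b).Δ ≠ 0) :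
    IsNormalizedIsogeny (torsionCurve 5 a b) (quotientCurve 5 a b)
      (X * (X * (X - C (a * b))) ^ 2 +
        (C (-(a ^ 2 * b * (a - b))) * X + C (a ^ 4 * b ^ 2)) * (X - C (a * b)) ^ 2 +
        (C (a * b ^ 2 * (a + b)) * (X - C (a * b)) + C (a ^ 2 * b ^ 4)) * X ^ 2)
      (X * (X - C (a * b)))
      ((X * (X - C (a * b))) ^ 3 -
        ((C (-(a ^ 2 * b * (a - b))) * X + C (2 * (a ^ 4 * b ^ 2))) * (X - C (a * b)) ^ 3 +
        (C (a * b ^ 2 * (a + b)) * (X - C (a * b)) + C (2 * (a ^ 2 * b ^ 4))) * X ^ 3)) 2 := by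
  have hM := natDegree_and_coeff_of_monic (D := X * (X - C (a * b))) (m := 2)
    (S := (C (-(a ^ 2 * b * (a - b))) * X + C (2 * (a ^ 4 * b ^ 2))) * (X - C (a * b)) ^ 3 +
        (C (a * b ^ 2 * (a + b)) * (X - C (a * b)) + C (2 * (a ^ 2 * b ^ 4))) * X ^ 3)
    (monic_X.mul (monic_X_sub_C _))
    (by rw [monic_X.natDegree_mul (monic_X_sub_C _), natDegree_X, natDegree_X_sub_C])
    (Nat.lt_of_le_of_lt (m := 4) (by compute_degree) (by norm_num))
  refine ⟨rfl, rfl, hΔ, by compute_degree, by compute_degree, hM.1, hM.2, ?_, ?_⟩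
  · refine (isCoprime_X_of_eval_ne_zero ?_).mul_right (isCoprime_X_sub_C_of_eval_ne_zero ?_)
    · simp [ha, hb]
    · simp [ha, hb]
  · refine Polynomial.funext fun x => ?_
    simp only [torsionCurve_five, quotientCurve, if_pos, WeierstrassCurve.b₂, WeierstrassCurve.b₄,
      WeierstrassCurve.b₆, eval_add, eval_mul, eval_sub, eval_pow, eval_X, eval_C, eval_ofNat]
    ring

/-- The point `2P` for `P = (0, 0)`; the relation `5P = 0` holds because `3P = -2P`. -/
theorem multiples_five (ha : a ≠ 0) (hb : b ≠ 0) (hΔ : (torsionCurve 5 a b).Δ ≠ 0) :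
    ∃ (h₁ : (torsionCurve 5 a b).toAffine.Nonsingular 0 0)
      (h₂ : (torsionCurve 5 a b).toAffine.Nonsingular (a * b) (a * b ^ 2)),
      2 • Affine.Point.some 0 0 h₁ = .some _ _ h₂ ∧ 5 • Affine.Point.some 0 0 h₁ = 0 := by
  have hns : ∀ {x y : ℚ}, (torsionCurve 5 a b).toAffine.Equation x y →
      (torsionCurve 5 a b).toAffine.Nonsingular x y := fun h =>
    (Affine.equation_iff_nonsingular_of_Δ_ne_zero hΔ).mp h
  have hab : a * b ≠ 0 := mul_ne_zero ha hb
  have h₁ : (torsionCurve 5 a b).toAffine.Nonsingular 0 0 :=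
    hns ((Affine.equation_iff _ _).mpr (by simp [torsionCurve_five]))
  have h₂ : (torsionCurve 5 a b).toAffine.Nonsingular (a * b) (a * b ^ 2) :=
    hns ((Affine.equation_iff _ _).mpr (by simp only [torsionCurve_five]; ring))
  have h₃ : (torsionCurve 5 a b).toAffine.Nonsingular (a * b) 0 :=
    hns ((Affine.equation_iff _ _).mpr (by simp only [torsionCurve_five]; ring))
  have e₂ : 2 • Affine.Point.some 0 0 h₁ = .some _ _ h₂ :=
    two_nsmul_some_eq h₂ 0 (by simp [torsionCurve_five, ha, hb]) (by simp [torsionCurve_five])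
      (by simp [torsionCurve_five]) (by simp only [torsionCurve_five]; ring)
  have e₃ : 3 • Affine.Point.some 0 0 h₁ = .some _ _ h₃ := by
    refine (succ_nsmul _ 2).trans (e₂ ▸ ?_)
    exact some_add_some_eq h₃ b hab (by ring) (by simp only [torsionCurve_five]; ring)
      (by simp only [torsionCurve_five]; ring)
  refine ⟨h₁, h₂, e₂, ?_⟩
  refine (add_nsmul _ 2 3).trans (e₂ ▸ e₃ ▸ ?_)
  exact Affine.Point.add_of_Y_eq rfl (by simp only [Affine.negY, torsionCurve_five]; ring)

open Polynomial in
theorem addOrderOf_and_isQuotientBy_five (ha : a ≠ 0) (hb : b ≠ 0)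
    (hΔ : (torsionCurve 5 a b).Δ ≠ 0) (hΔ' : (quotientCurve 5 a b).Δ ≠ 0) :
    ∃ h : (torsionCurve 5 a b).toAffine.Nonsingular 0 0, addOrderOf (Affine.Point.some 0 0 h) = 5 ∧
      IsQuotientBy (torsionCurve 5 a b) (Affine.Point.some 0 0 h) (quotientCurve 5 a b) := by
  obtain ⟨h₁, h₂, e₂, e₅⟩ := multiples_five ha hb hΔ
  have : Fact (Nat.Prime 5) := ⟨by norm_num⟩
  have hord : addOrderOf (Affine.Point.some 0 0 h₁) = 5 :=
    addOrderOf_eq_prime e₅ (Affine.Point.some_ne_zero h₁)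
  refine ⟨h₁, hord, (isNormalizedIsogeny_five ha hb hΔ').isQuotientBy two_ne_zero ?_ ?_⟩
  · refine eval_eq_zero_of_zsmul (m := 2) e₅ fun k hk0 hk => ?_
    interval_cases k
    · exact absurd rfl hk0
    · exact ⟨0, 0, h₁, one_nsmul _, by simp⟩
    · exact ⟨_, _, h₂, e₂, by simp⟩
  · intro x hx
    rw [map_mul, map_sub, aeval_X, aeval_C, mul_eq_zero, sub_eq_zero] at hx
    rcases hx with rfl | rfl
    · exact ⟨1, 0, 0, h₁, one_zsmul _, map_zero _⟩
    · exact ⟨2, _, _, h₂, by exact_mod_cast e₂, rfl⟩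
end Five

/-! ### The family with a point of order `7` -/

section Seven
variable {a b : ℚ}

theorem torsionCurve_seven (a b : ℚ) : torsionCurve 7 a b =
    ⟨a ^ 2 + a * b - b ^ 2, a ^ 2 * b ^ 2 - a * b ^ 3, a ^ 4 * b ^ 2 - a ^ 3 * b ^ 3, 0, 0⟩ := rfl

theorem quotientCurve_seven (a b : ℚ) : quotientCurve 7 a b =
    ⟨a ^ 2 + a * b - b ^ 2, a ^ 2 * b ^ 2 - a * b ^ 3, a ^ 4 * b ^ 2 - a ^ 3 * b ^ 3,
      5 * a * b * (a - b) * (a ^ 2 - b * a + b ^ 2) *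
        (a ^ 3 - 5 * a ^ 2 * b + 2 * a * b ^ 2 + b ^ 3),
      a * b * (a - b) *
        (a ^ 9 - 18 * a ^ 8 * b + 76 * a ^ 7 * b ^ 2 - 182 * a ^ 6 * b ^ 3 +
          211 * a ^ 5 * b ^ 4 - 132 * a ^ 4 * b ^ 5 + 70 * a ^ 3 * b ^ 6 -
          37 * a ^ 2 * b ^ 7 + 9 * a * b ^ 8 + b ^ 9)⟩ := rfl

theorem torsionCurve_seven_Δ (a b : ℚ) :
    (torsionCurve 7 a b).Δ =
      -(a ^ 7 * b ^ 7 * (a - b) ^ 7 * (a ^ 3 + 5 * a ^ 2 * b - 8 * a * b ^ 2 + b ^ 3)) := by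
  simp only [torsionCurve_seven, WeierstrassCurve.Δ, WeierstrassCurve.b₂, WeierstrassCurve.b₄,
    WeierstrassCurve.b₆, WeierstrassCurve.b₈]
  ring

set_option maxHeartbeats 4000000 in
/-- The identity behind the isogeny of degree `7`, in the coordinate `z = x / (ab(a - b))`. This
coordinate removes the common powers of `ab(a - b)` and so keeps the expansion small. -/
theorem seven_identity {z a b A D M : ℚ} (hD : D = z * (z + b) * (z + a))
    (hA : A = a * b * (a - b) * z * D ^ 2 +
      ((a ^ 2 + a * b - b ^ 2) * a ^ 2 * b * z + a ^ 4 * b ^ 2) * ((z + b) * (z + a)) ^ 2 +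
      ((6 * a * b ^ 3 * (a - b) - ((a ^ 2 + a * b - b ^ 2) ^ 2 + 4 * (a * b ^ 2 * (a - b))) * b +
        (a ^ 2 + a * b - b ^ 2) * a ^ 2 * b) * (z + b) + b ^ 4 * (a - b) ^ 2) * (z * (z + a)) ^ 2 +
      ((6 * a ^ 3 * b * (a - b) - ((a ^ 2 + a * b - b ^ 2) ^ 2 + 4 * (a * b ^ 2 * (a - b))) * a +
        (a ^ 2 + a * b - b ^ 2) * a ^ 2 * b) * (z + a) + a ^ 2 * (a - b) ^ 4) * (z * (z + b)) ^ 2)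
    (hM : M = a * b * (a - b) * D ^ 3 -
      (((a ^ 2 + a * b - b ^ 2) * a ^ 2 * b * z + 2 * (a ^ 4 * b ^ 2)) * ((z + b) * (z + a)) ^ 3 +
      ((6 * a * b ^ 3 * (a - b) - ((a ^ 2 + a * b - b ^ 2) ^ 2 + 4 * (a * b ^ 2 * (a - b))) * b +
        (a ^ 2 + a * b - b ^ 2) * a ^ 2 * b) * (z + b) + 2 * (b ^ 4 * (a - b) ^ 2)) *
          (z * (z + a)) ^ 3 +
      ((6 * a ^ 3 * b * (a - b) - ((a ^ 2 + a * b - b ^ 2) ^ 2 + 4 * (a * b ^ 2 * (a - b))) * a +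
        (a ^ 2 + a * b - b ^ 2) * a ^ 2 * b) * (z + a) + 2 * (a ^ 2 * (a - b) ^ 4)) *
          (z * (z + b)) ^ 3)) :
    (4 * (a * b * (a - b)) * z ^ 3 +
      ((a ^ 2 + a * b - b ^ 2) ^ 2 + 4 * (a * b ^ 2 * (a - b))) * z ^ 2 +
      2 * (a ^ 2 + a * b - b ^ 2) * a ^ 2 * b * z + a ^ 4 * b ^ 2) * M ^ 2 =
    4 * A ^ 3 + (quotientCurve 7 a b).b₂ * A ^ 2 * D ^ 2 +
      2 * (quotientCurve 7 a b).b₄ * A * D ^ 4 + (quotientCurve 7 a b).b₆ * D ^ 6 := by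
  subst hA hM hD
  simp only [quotientCurve_seven, WeierstrassCurve.b₂, WeierstrassCurve.b₄, WeierstrassCurve.b₆]
  ring

open Polynomial in
/-- The sum `∑ (t (x - x_Q) + r u) (D / (x - x_Q))ⁿ` over the nonzero points of the kernel up to
sign, with the coefficients `t` and `u` of Vélu's formulas. The coordinate `X` of the isogeny has
the numerator `x D² + ∑ (t (x - x_Q) + u) (D / (x - x_Q))²`, and its derivative has the numerator
`D³ - ∑ (t (x - x_Q) + 2u) (D / (x - x_Q))³`. -/
noncomputable def sevenNum (a b : ℚ) (r : ℚ) (n : ℕ) : ℚ[X] :=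
  (C ((a ^ 2 + a * b - b ^ 2) * (a ^ 3 * b ^ 2 * (a - b))) * X +
      C (r * (a ^ 3 * b ^ 2 * (a - b)) ^ 2)) *
    ((X + C (a * b ^ 2 * (a - b))) * (X + C (a ^ 2 * b * (a - b)))) ^ n +
  (C (a * b * (a - b) * (6 * a * b ^ 3 * (a - b) -
      ((a ^ 2 + a * b - b ^ 2) ^ 2 + 4 * (a * b ^ 2 * (a - b))) * b +
      (a ^ 2 + a * b - b ^ 2) * a ^ 2 * b)) * (X + C (a * b ^ 2 * (a - b))) +
      C (r * (a * b ^ 3 * (a - b) ^ 2) ^ 2)) *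
    (X * (X + C (a ^ 2 * b * (a - b)))) ^ n +
  (C (a * b * (a - b) * (6 * a ^ 3 * b * (a - b) -
      ((a ^ 2 + a * b - b ^ 2) ^ 2 + 4 * (a * b ^ 2 * (a - b))) * a +
      (a ^ 2 + a * b - b ^ 2) * a ^ 2 * b)) * (X + C (a ^ 2 * b * (a - b))) +
      C (r * (a ^ 2 * b * (a - b) ^ 3) ^ 2)) *
    (X * (X + C (a * b ^ 2 * (a - b)))) ^ n

open Polynomial in
/-- The polynomial with simple roots at the `x`-coordinates of the nonzero points of the kernel. -/
noncomputable def sevenKer (a b : ℚ) : ℚ[X] :=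
  X * (X + C (a * b ^ 2 * (a - b))) * (X + C (a ^ 2 * b * (a - b)))

open Polynomial in
theorem isNormalizedIsogeny_seven (ha : a ≠ 0) (hb : b ≠ 0) (hab : a - b ≠ 0)
    (hΔ : (quotientCurve 7 a b).Δ ≠ 0) :
    IsNormalizedIsogeny (torsionCurve 7 a b) (quotientCurve 7 a b)
      (X * sevenKer a b ^ 2 + sevenNum a b 1 2) (sevenKer a b)
      (sevenKer a b ^ 3 - sevenNum a b 2 3) 3 := by
  have hmonic : (sevenKer a b).Monic :=
    (monic_X.mul (monic_X_add_C _)).mul (monic_X_add_C _)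
  have hdeg : (sevenKer a b).natDegree = 3 := by
    rw [sevenKer, (monic_X.mul (monic_X_add_C _)).natDegree_mul (monic_X_add_C _),
      monic_X.natDegree_mul (monic_X_add_C _), natDegree_X, natDegree_X_add_C, natDegree_X_add_C]
  have hM := natDegree_and_coeff_of_monic (S := sevenNum a b 2 3) hmonic hdeg
    (Nat.lt_of_le_of_lt (m := 7) (by rw [sevenNum]; compute_degree) (by norm_num))
  refine ⟨rfl, rfl, hΔ, by rw [sevenKer, sevenNum]; compute_degree, hdeg.le, hM.1, hM.2, ?_, ?_⟩
  · have hco : ∀ c : ℚ, (X * sevenKer a b ^ 2 + sevenNum a b 1 2).eval (-c) ≠ 0 →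
        IsCoprime (X * sevenKer a b ^ 2 + sevenNum a b 1 2) (X + C c) := fun c hc => by
      simpa using isCoprime_X_sub_C_of_eval_ne_zero hc
    refine ((isCoprime_X_of_eval_ne_zero ?_).mul_right (hco _ ?_)).mul_right (hco _ ?_)
    · simp [sevenKer, sevenNum, ha, hb, hab]
    -- at a root `x_Q` of `D`, the value of the numerator is `u (D / (x - x_Q))²`
    · have : (X * sevenKer a b ^ 2 + sevenNum a b 1 2).eval (-(a * b ^ 2 * (a - b))) =
          (a * b ^ 3 * (a - b) ^ 2) ^ 2 * ((a * b ^ 2 * (a - b)) * (a * b * (a - b) ^ 2)) ^ 2 := by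
        simp only [sevenKer, sevenNum, eval_add, eval_mul, eval_pow, eval_X, eval_C]
        ring
      rw [this]
      simp [ha, hb, hab]
    · have : (X * sevenKer a b ^ 2 + sevenNum a b 1 2).eval (-(a ^ 2 * b * (a - b))) =
          (a ^ 2 * b * (a - b) ^ 3) ^ 2 * ((a ^ 2 * b * (a - b)) * (a * b * (a - b) ^ 2)) ^ 2 := by
        simp only [sevenKer, sevenNum, eval_add, eval_mul, eval_pow, eval_X, eval_C]
        ring
      rw [this]
      simp [ha, hb, hab]
  · refine Polynomial.funext fun x => ?_
    have hk : a * b * (a - b) ≠ 0 := mul_ne_zero (mul_ne_zero ha hb) hab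
    obtain ⟨z, rfl⟩ : ∃ z, x = a * b * (a - b) * z := ⟨x / (a * b * (a - b)), by field_simp⟩
    obtain ⟨D', hD'⟩ : ∃ D', D' = z * (z + b) * (z + a) := ⟨_, rfl⟩
    have hD : (sevenKer a b).eval (a * b * (a - b) * z) = (a * b * (a - b)) ^ 3 * D' := by
      simp only [sevenKer, eval_add, eval_mul, eval_X, eval_C, hD']
      ring
    obtain ⟨A', hA'⟩ : ∃ A', (X * sevenKer a b ^ 2 + sevenNum a b 1 2).eval (a * b * (a - b) * z) =
        (a * b * (a - b)) ^ 6 * A' := ⟨_, (mul_div_cancel₀ _ (pow_ne_zero _ hk)).symm⟩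
    obtain ⟨M', hM'⟩ : ∃ M', (sevenKer a b ^ 3 - sevenNum a b 2 3).eval (a * b * (a - b) * z) =
        (a * b * (a - b)) ^ 8 * M' := ⟨_, (mul_div_cancel₀ _ (pow_ne_zero _ hk)).symm⟩
    have key := seven_identity (A := A') (M := M') hD'
      (by
        refine mul_left_cancel₀ (pow_ne_zero 6 hk) (hA'.symm.trans ?_)
        simp only [sevenKer, sevenNum, eval_add, eval_mul, eval_pow, eval_X, eval_C, hD']
        ring)
      (by
        refine mul_left_cancel₀ (pow_ne_zero 8 hk) (hM'.symm.trans ?_)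
        simp only [sevenKer, sevenNum, eval_sub, eval_add, eval_mul, eval_pow, eval_X, eval_C, hD']
        ring)
    generalize X * sevenKer a b ^ 2 + sevenNum a b 1 2 = A at hA' ⊢
    generalize sevenKer a b ^ 3 - sevenNum a b 2 3 = M at hM' ⊢
    generalize sevenKer a b = D at hD ⊢
    simp only [eval_add, eval_mul, eval_pow, eval_X, eval_C, eval_ofNat, hA', hM', hD]
    simp only [torsionCurve_seven, WeierstrassCurve.b₂, WeierstrassCurve.b₄,
      WeierstrassCurve.b₆] at key ⊢
    linear_combination (a * b * (a - b)) ^ 18 * key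

/-- The points `2P` and `3P` for `P = (0, 0)`; the relation `7P = 0` holds because `4P = -3P`. -/
theorem multiples_seven (ha : a ≠ 0) (hb : b ≠ 0) (hab : a - b ≠ 0)
    (hΔ : (torsionCurve 7 a b).Δ ≠ 0) :
    ∃ (h₁ : (torsionCurve 7 a b).toAffine.Nonsingular 0 0)
      (h₂ : (torsionCurve 7 a b).toAffine.Nonsingular (-(a * b ^ 2 * (a - b)))
        (a * b ^ 3 * (a - b) ^ 2))
      (h₃ : (torsionCurve 7 a b).toAffine.Nonsingular (-(a ^ 2 * b * (a - b)))
        (a ^ 3 * b * (a - b) ^ 2)),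
      2 • Affine.Point.some 0 0 h₁ = .some _ _ h₂ ∧ 3 • Affine.Point.some 0 0 h₁ = .some _ _ h₃ ∧
        7 • Affine.Point.some 0 0 h₁ = 0 := by
  have hns : ∀ {x y : ℚ}, (torsionCurve 7 a b).toAffine.Equation x y →
      (torsionCurve 7 a b).toAffine.Nonsingular x y := fun h =>
    (Affine.equation_iff_nonsingular_of_Δ_ne_zero hΔ).mp h
  have h₁ : (torsionCurve 7 a b).toAffine.Nonsingular 0 0 :=
    hns ((Affine.equation_iff _ _).mpr (by simp [torsionCurve_seven]))
  have h₂ : (torsionCurve 7 a b).toAffine.Nonsingular (-(a * b ^ 2 * (a - b)))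
      (a * b ^ 3 * (a - b) ^ 2) :=
    hns ((Affine.equation_iff _ _).mpr (by simp only [torsionCurve_seven]; ring))
  have h₃ : (torsionCurve 7 a b).toAffine.Nonsingular (-(a ^ 2 * b * (a - b)))
      (a ^ 3 * b * (a - b) ^ 2) :=
    hns ((Affine.equation_iff _ _).mpr (by simp only [torsionCurve_seven]; ring))
  have h₄ : (torsionCurve 7 a b).toAffine.Nonsingular (-(a ^ 2 * b * (a - b)))
      (a ^ 2 * b ^ 2 * (a - b) ^ 2) :=
    hns ((Affine.equation_iff _ _).mpr (by simp only [torsionCurve_seven]; ring))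
  have ha₃ : a ^ 4 * b ^ 2 - a ^ 3 * b ^ 3 ≠ 0 := by
    rw [show a ^ 4 * b ^ 2 - a ^ 3 * b ^ 3 = a ^ 3 * b ^ 2 * (a - b) by ring]
    simp [ha, hb, hab]
  have e₂ : 2 • Affine.Point.some 0 0 h₁ = .some _ _ h₂ :=
    two_nsmul_some_eq h₂ 0 (by simpa [torsionCurve_seven] using ha₃) (by simp [torsionCurve_seven])
      (by simp only [torsionCurve_seven]; ring) (by simp only [torsionCurve_seven]; ring)
  have e₃ : 3 • Affine.Point.some 0 0 h₁ = .some _ _ h₃ := by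
    refine (succ_nsmul _ 2).trans (e₂ ▸ ?_)
    exact some_add_some_eq h₃ (-(b * (a - b))) (by simp [ha, hb, hab]) (by ring)
      (by simp only [torsionCurve_seven]; ring) (by simp only [torsionCurve_seven]; ring)
  have e₄ : 4 • Affine.Point.some 0 0 h₁ = .some _ _ h₄ := by
    refine (succ_nsmul _ 3).trans (e₃ ▸ ?_)
    exact some_add_some_eq h₄ (-(a * (a - b))) (by simp [ha, hb, hab]) (by ring)
      (by simp only [torsionCurve_seven]; ring) (by simp only [torsionCurve_seven]; ring)
  refine ⟨h₁, h₂, h₃, e₂, e₃, ?_⟩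
  refine (add_nsmul _ 3 4).trans (e₃ ▸ e₄ ▸ ?_)
  exact Affine.Point.add_of_Y_eq rfl (by simp only [Affine.negY, torsionCurve_seven]; ring)

open Polynomial in
theorem addOrderOf_and_isQuotientBy_seven (ha : a ≠ 0) (hb : b ≠ 0) (hab : a - b ≠ 0)
    (hΔ : (torsionCurve 7 a b).Δ ≠ 0) (hΔ' : (quotientCurve 7 a b).Δ ≠ 0) :
    ∃ h : (torsionCurve 7 a b).toAffine.Nonsingular 0 0, addOrderOf (Affine.Point.some 0 0 h) = 7 ∧
      IsQuotientBy (torsionCurve 7 a b) (Affine.Point.some 0 0 h) (quotientCurve 7 a b) := by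
  obtain ⟨h₁, h₂, h₃, e₂, e₃, e₇⟩ := multiples_seven ha hb hab hΔ
  have : Fact (Nat.Prime 7) := ⟨by norm_num⟩
  have hord : addOrderOf (Affine.Point.some 0 0 h₁) = 7 :=
    addOrderOf_eq_prime e₇ (Affine.Point.some_ne_zero h₁)
  refine ⟨h₁, hord, (isNormalizedIsogeny_seven ha hb hab hΔ').isQuotientBy three_ne_zero ?_ ?_⟩
  · refine eval_eq_zero_of_zsmul (m := 3) e₇ fun k hk0 hk => ?_
    interval_cases k
    · exact absurd rfl hk0
    · exact ⟨0, 0, h₁, one_nsmul _, by simp [sevenKer]⟩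
    · exact ⟨_, _, h₂, e₂, by simp [sevenKer]⟩
    · exact ⟨_, _, h₃, e₃, by simp [sevenKer]⟩
  · intro x hx
    rw [sevenKer, map_mul, map_mul, map_add, map_add, aeval_X, aeval_C, aeval_C, mul_eq_zero,
      mul_eq_zero, add_eq_zero_iff_eq_neg, add_eq_zero_iff_eq_neg] at hx
    rcases hx with (rfl | rfl) | rfl
    · exact ⟨1, 0, 0, h₁, one_zsmul _, map_zero _⟩
    · exact ⟨2, _, _, h₂, by exact_mod_cast e₂, map_neg _ _⟩
    · exact ⟨3, _, _, h₃, by exact_mod_cast e₃, map_neg _ _⟩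
end Seven

/-! ### Nonvanishing of the discriminants -/

section Nonvanishing

theorem eq_one_of_coprime_of_dvd_pow {a b n : ℕ} (h : a.Coprime b) (hd : (a : ℤ) ∣ (b : ℤ) ^ n) :
    a = 1 :=
  Nat.Coprime.eq_one_of_dvd (h.pow_right n) (by exact_mod_cast hd)

/-- A zero would force `a ∣ b²` and `b ∣ a²`, hence `a = b = 1`. -/
theorem quadratic_factor_ne_zero {a b : ℕ} (h : a.Coprime b) :
    (a : ℤ) ^ 2 + 11 * a * b - b ^ 2 ≠ 0 := by
  intro h0
  obtain rfl := eq_one_of_coprime_of_dvd_pow (n := 2) h ⟨a + 11 * b, by linear_combination -h0⟩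
  obtain rfl := eq_one_of_coprime_of_dvd_pow (n := 2) h.symm ⟨b - 11, by
    linear_combination h0⟩
  norm_num at h0

theorem cubic_factor_ne_zero {a b : ℕ} (h : a.Coprime b) :
    (a : ℤ) ^ 3 + 5 * a ^ 2 * b - 8 * a * b ^ 2 + b ^ 3 ≠ 0 := by
  intro h0
  obtain rfl := eq_one_of_coprime_of_dvd_pow (n := 3) h
    ⟨-(a ^ 2 + 5 * a * b - 8 * b ^ 2), by linear_combination h0⟩
  obtain rfl := eq_one_of_coprime_of_dvd_pow (n := 3) h.symm ⟨-(5 - 8 * b + b ^ 2), by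
    linear_combination h0⟩
  norm_num at h0

theorem Admissible.ne {ℓ a b : ℕ} (h : Admissible ℓ a b) : a ≠ b := by
  rintro rfl
  obtain ⟨-, -, hcop, q, hq, hqa, -⟩ := h
  rw [(Nat.coprime_self a).mp hcop] at hqa
  exact hq.one_lt.ne' (Nat.dvd_one.mp hqa)

theorem Admissible.quotientModel_Δ_ne_zero {ℓ a b : ℕ} (hℓ : ℓ = 5 ∨ ℓ = 7)
    (h : Admissible ℓ a b) : (quotientModel ℓ (a : ℤ) b).Δ ≠ 0 := by
  have ha : (a : ℤ) ≠ 0 := by exact_mod_cast h.1.ne'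
  have hb : (b : ℤ) ≠ 0 := by exact_mod_cast h.2.1.ne'
  rcases hℓ with rfl | rfl
  · rw [quotientModel_five_Δ]
    exact neg_ne_zero.mpr (mul_ne_zero (mul_ne_zero ha hb)
      (pow_ne_zero 5 (quadratic_factor_ne_zero h.2.2.1)))
  · rw [quotientModel_seven_Δ]
    have hab : (a : ℤ) - b ≠ 0 := sub_ne_zero.mpr (by exact_mod_cast h.ne)
    exact neg_ne_zero.mpr (mul_ne_zero (mul_ne_zero (mul_ne_zero ha hb) hab)
      (pow_ne_zero 7 (cubic_factor_ne_zero h.2.2.1)))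

theorem Admissible.quotientCurve_Δ_ne_zero {ℓ a b : ℕ} (hℓ : ℓ = 5 ∨ ℓ = 7)
    (h : Admissible ℓ a b) : (quotientCurve ℓ a b).Δ ≠ 0 := by
  rw [quotientCurve_natCast, map_Δ, eq_intCast]
  exact_mod_cast h.quotientModel_Δ_ne_zero hℓ

theorem Admissible.torsionCurve_Δ_ne_zero {ℓ a b : ℕ} (hℓ : ℓ = 5 ∨ ℓ = 7)
    (h : Admissible ℓ a b) : (torsionCurve ℓ a b).Δ ≠ 0 := by
  have ha : (a : ℚ) ≠ 0 := by exact_mod_cast h.1.ne'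
  have hb : (b : ℚ) ≠ 0 := by exact_mod_cast h.2.1.ne'
  rcases hℓ with rfl | rfl
  · rw [torsionCurve_five_Δ]
    exact neg_ne_zero.mpr (mul_ne_zero (mul_ne_zero (pow_ne_zero 5 ha) (pow_ne_zero 5 hb))
      (by exact_mod_cast quadratic_factor_ne_zero h.2.2.1))
  · rw [torsionCurve_seven_Δ]
    have hab : (a : ℚ) - b ≠ 0 := sub_ne_zero.mpr (by exact_mod_cast h.ne)
    exact neg_ne_zero.mpr (mul_ne_zero (mul_ne_zero (mul_ne_zero (pow_ne_zero 7 ha)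
      (pow_ne_zero 7 hb)) (pow_ne_zero 7 hab)) (by exact_mod_cast cubic_factor_ne_zero h.2.2.1))

theorem Admissible.addOrderOf_and_isQuotientBy {ℓ a b : ℕ} (hℓ : ℓ = 5 ∨ ℓ = 7)
    (h : Admissible ℓ a b) :
    ∃ hns : (torsionCurve ℓ a b).toAffine.Nonsingular 0 0,
      addOrderOf (Affine.Point.some 0 0 hns) = ℓ ∧
      IsQuotientBy (torsionCurve ℓ a b) (Affine.Point.some 0 0 hns) (quotientCurve ℓ a b) := by
  have hΔ := h.torsionCurve_Δ_ne_zero hℓ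
  have hΔ' := h.quotientCurve_Δ_ne_zero hℓ
  have ha : (a : ℚ) ≠ 0 := by exact_mod_cast h.1.ne'
  have hb : (b : ℚ) ≠ 0 := by exact_mod_cast h.2.1.ne'
  rcases hℓ with rfl | rfl
  · exact addOrderOf_and_isQuotientBy_five ha hb hΔ hΔ'
  · exact addOrderOf_and_isQuotientBy_seven ha hb
      (sub_ne_zero.mpr (by exact_mod_cast h.ne)) hΔ hΔ'

end Nonvanishing

/-! ### Infinitely many isomorphism classes -/

section InfinitelyManyClasses

/-- Isomorphic curves have the same `j`-invariant `c₄³ / Δ`. -/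
theorem c₄_pow_mul_Δ_eq_of_isoClass_eq {W W' : WeierstrassCurve ℤ}
    (h : isoClass (W.map (Int.castRingHom ℚ)) = isoClass (W'.map (Int.castRingHom ℚ))) :
    W.c₄ ^ 3 * W'.Δ = W'.c₄ ^ 3 * W.Δ := by
  obtain ⟨C, hC⟩ : ∃ C : VariableChange ℚ,
      C • W'.map (Int.castRingHom ℚ) = W.map (Int.castRingHom ℚ) := Quotient.exact h
  have hc := congrArg WeierstrassCurve.c₄ hC
  have hΔ := congrArg WeierstrassCurve.Δ hC
  rw [variableChange_c₄, map_c₄, map_c₄, eq_intCast, eq_intCast] at hc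
  rw [variableChange_Δ, map_Δ, map_Δ, eq_intCast, eq_intCast] at hΔ
  have : (W.c₄ : ℚ) ^ 3 * W'.Δ = W'.c₄ ^ 3 * W.Δ := by
    rw [← hc, ← hΔ]
    ring
  exact_mod_cast this

theorem le_of_two_pow_mul_eq {m n : ℕ} {u v : ℤ} (hv : Odd v) (h : 2 ^ m * u = 2 ^ n * v) :
    m ≤ n := by
  by_contra! hlt
  obtain ⟨k, rfl⟩ := Nat.exists_eq_add_of_lt hlt
  have hv' : v = 2 * (2 ^ k * u) :=
    mul_left_cancel₀ (pow_ne_zero n two_ne_zero) (h.symm.trans (by ring))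
  exact (Int.not_odd_iff_even.mpr (hv' ▸ even_two_mul _)) hv

theorem odd_c₄ {W : WeierstrassCurve ℤ} (h : Odd W.a₁) : Odd W.c₄ := by
  rw [c₄, b₂, show (W.a₁ ^ 2 + 4 * W.a₂) ^ 2 - 24 * W.b₄ =
    W.a₁ ^ 4 + 2 * (4 * W.a₁ ^ 2 * W.a₂ + 8 * W.a₂ ^ 2 - 12 * W.b₄) by ring]
  exact h.pow.add_even (even_two_mul _)

theorem odd_a₁_and_Δ_eq {ℓ : ℕ} (hℓ : ℓ = 5 ∨ ℓ = 7) {b : ℤ} (hb : Even b) :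
    Odd (quotientModel ℓ 1 b).a₁ ∧ ∃ u : ℤ, Odd u ∧ (quotientModel ℓ 1 b).Δ = b * u := by
  rcases hℓ with rfl | rfl
  · refine ⟨odd_one.sub_even hb, -(1 ^ 2 + 11 * 1 * b - b ^ 2) ^ 5, ?_, ?_⟩
    · simp [hb, parity_simps]
    · rw [quotientModel_five_Δ]; ring
  · refine ⟨?_, -((1 - b) * (1 ^ 3 + 5 * 1 ^ 2 * b - 8 * 1 * b ^ 2 + b ^ 3) ^ 7), ?_, ?_⟩
    · simp [quotientModel, hb, parity_simps]
    · simp [hb, parity_simps]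
    · rw [quotientModel_seven_Δ]; ring

theorem admissible_one_two_pow {ℓ : ℕ} (hℓ : ℓ ≠ 0) (n : ℕ) :
    Admissible ℓ 1 (2 ^ (ℓ * (n + 1))) := by
  refine ⟨one_pos, by positivity, Nat.coprime_one_left _, 2, Nat.prime_two, ?_, ?_⟩
  · rw [one_mul]
    exact dvd_pow_self 2 (by positivity)
  · rw [one_mul, Nat.prime_two.factorization_pow, Finsupp.single_eq_same]
    exact dvd_mul_right _ _

/-- For `a = 1` and `b = 2 ^ (ℓn)` with `n ≥ 1`, the `2`-adic valuation of the `j`-invariant is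
`-ℓn`, because `c₄` is odd and `Δ` is `b` times an odd number. -/
theorem infinite_isoClass_quotientCurve {ℓ : ℕ} (hℓ : ℓ = 5 ∨ ℓ = 7) :
    {c : IsoClass | ∃ a b : ℕ, Admissible ℓ a b ∧ c = isoClass (quotientCurve ℓ a b)}.Infinite := by
  have hℓ0 : 0 < ℓ := by omega
  refine Set.infinite_of_injective_forall_mem
    (f := fun n : ℕ => isoClass (quotientCurve ℓ (1 : ℕ) (2 ^ (ℓ * (n + 1)) : ℕ)))
    (fun m n h => ?_) (fun n => ⟨_, _, admissible_one_two_pow hℓ0.ne' n, rfl⟩)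
  have hle : ∀ m n : ℕ, isoClass (quotientCurve ℓ (1 : ℕ) (2 ^ (ℓ * (m + 1)) : ℕ)) =
      isoClass (quotientCurve ℓ (1 : ℕ) (2 ^ (ℓ * (n + 1)) : ℕ)) → m ≤ n := by
    intro m n h
    rw [quotientCurve_natCast, quotientCurve_natCast] at h
    push_cast at h
    have heven : ∀ k : ℕ, Even ((2 : ℤ) ^ (ℓ * (k + 1))) := fun k =>
      even_two.pow_of_ne_zero (by positivity)
    obtain ⟨hm, u, -, hu'⟩ := odd_a₁_and_Δ_eq hℓ (heven m)
    obtain ⟨hn, v, hv, hv'⟩ := odd_a₁_and_Δ_eq hℓ (heven n)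
    have key := c₄_pow_mul_Δ_eq_of_isoClass_eq h
    rw [hu', hv', mul_left_comm, mul_left_comm _ _ u] at key
    have := le_of_two_pow_mul_eq ((odd_c₄ hm).pow.mul hv) key.symm
    exact Nat.succ_le_succ_iff.mp (Nat.le_of_mul_le_mul_left this hℓ0)
  exact le_antisymm (hle m n h) (hle n m h.symm)

end InfinitelyManyClasses
end TamagawaIsogeny
theorem proposition5p1 (ℓ : ℕ) (hℓ : ℓ = 5 ∨ ℓ = 7) :
    -- infinitely many isomorphism classes of quotients with Tamagawa number divisible by `ℓ`
    {c : TamagawaIsogeny.IsoClass |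
      ∃ (E E' : WeierstrassCurve ℚ) (P : E.toAffine.Point),
        E.IsElliptic ∧ addOrderOf P = ℓ ∧
        E'.IsElliptic ∧ TamagawaIsogeny.IsQuotientBy E P E' ∧
        ℓ ∣ TamagawaIsogeny.globalTamagawa E' ∧
        c = TamagawaIsogeny.isoClass E'}.Infinite ∧
    -- all admissible parameters give such quotients
    (∀ a b : ℕ, TamagawaIsogeny.Admissible ℓ a b →
      (TamagawaIsogeny.torsionCurve ℓ a b).IsElliptic ∧
      (TamagawaIsogeny.quotientCurve ℓ a b).IsElliptic ∧
      (∃ h : (TamagawaIsogeny.torsionCurve ℓ a b).toAffine.Nonsingular 0 0,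
        addOrderOf (WeierstrassCurve.Affine.Point.some 0 0 h) = ℓ ∧
        TamagawaIsogeny.IsQuotientBy (TamagawaIsogeny.torsionCurve ℓ a b)
          (WeierstrassCurve.Affine.Point.some 0 0 h) (TamagawaIsogeny.quotientCurve ℓ a b)) ∧
      ℓ ∣ TamagawaIsogeny.globalTamagawa (TamagawaIsogeny.quotientCurve ℓ a b)) ∧
    -- and these quotients already fall into infinitely many isomorphism classes
    {c : TamagawaIsogeny.IsoClass |
      ∃ a b : ℕ, TamagawaIsogeny.Admissible ℓ a b ∧
        c = TamagawaIsogeny.isoClass (TamagawaIsogeny.quotientCurve ℓ a b)}.Infinite := by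

  have hparam : ∀ a b : ℕ, TamagawaIsogeny.Admissible ℓ a b → _ := fun a b h =>
    And.intro (⟨(h.torsionCurve_Δ_ne_zero hℓ).isUnit⟩ :
      (TamagawaIsogeny.torsionCurve ℓ a b).IsElliptic) <|
    And.intro (⟨(h.quotientCurve_Δ_ne_zero hℓ).isUnit⟩ :
      (TamagawaIsogeny.quotientCurve ℓ a b).IsElliptic) <|
    And.intro (h.addOrderOf_and_isQuotientBy hℓ)
      (TamagawaIsogeny.dvd_globalTamagawa_quotientCurve hℓ (h.quotientModel_Δ_ne_zero hℓ) h)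
  refine ⟨(TamagawaIsogeny.infinite_isoClass_quotientCurve hℓ).mono ?_, hparam,
    TamagawaIsogeny.infinite_isoClass_quotientCurve hℓ⟩
  rintro _ ⟨a, b, hab, rfl⟩
  obtain ⟨hE, hE', ⟨hns, hord, hquot⟩, hdvd⟩ := hparam a b hab
  exact ⟨_, _, _, hE, hord, hE', hquot, hdvd, rfl⟩
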